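/- Notation. Let $d\ge 0$. For a nonempty connected open set (a domain) $D\subset\mathbb C^d$ let $K_D$ be its Kobayashi pseudodistance; $D$ is complete hyperbolic if $(D,K_D)$ is a complete metric space. A geodesic of $D$ from $x$ to $y$ is the image of an isometric embedding of a compact interval into $(D,K_D)$ with endpoints $x,y$. $(D,K_D)$ is Gromov hyperbolic if it is a geodesic space and there is $\delta>0$ such that every side of every geodesic triangle lies in the $\delta$-neighbourhood $\{K_D\text{-distance}\le\delta\}$ of the union of the other two sides. Two distinct points $p\ne q$ of $\partial D$ (Euclidean boundary) satisfy the visibility condition for $D$ if there are disjoint neighbourhoods $V_p$ of $p$ and $V_q$ of $q$ in $\mathbb C^d$ and a compact set $K\subset D$ that meets every geodesic of $D$ joining a point of $V_p\cap D$ to a point of $V_q\cap D$. $D$ is visible if all pairs of distinct points of $\partial D$ satisfy it. Let $\Omega\subset\mathbb C^d$ be a bounded domain and $p\in\partial\Omega$. $\Omega$ is locally Gromov hyperbolic at $p$ if there is an open neighbourhood $U$ of $p$ such that $\Omega\cap U$ is connected and complete hyperbolic and $(\Omega\cap U,K_{\Omega\cap U})$ is Gromov hyperbolic. $\Omega$ is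 locally visible at $p$ if there are open neighbourhoods $V'\subseteq V$ of $p$ such that $\Omega\cap V$ is connected and complete hyperbolic and all $q_1\neq q_2$ in $\partial\Omega\cap V'$ satisfy the visibility condition for $\Omega\cap V$. For $\Omega$ with $(\Omega,K_\Omega)$ complete and Gromov hyperbolic and $o\in\Omega$, write $(x|y)_o=\tfrac12\big(K_\Omega(x,o)+K_\Omega(y,o)-K_\Omega(x,y)\big)$. The Gromov boundary $\partial_G\Omega$ is the set of sequences $(x_i)$ in $\Omega$ with $(x_i|x_j)_o\to\infty$ as $i,j\to\infty$, modulo $(x_i)\sim(y_j)$ iff $(x_i|y_j)_o\to\infty$ as $i,j\to\infty$. The Gromov compactification is $\overline\Omega^G=\Omega\cup\partial_G\Omega$ with the Gromov topology: basic neighbourhoods of a point of $\Omega$ are its $K_\Omega$-balls; basic neighbourhoods of $\xi\in\partial_G\Omega$ consist, for $R>0$, of the $y\in\Omega$ such that $(x_i|y)_o\ge R$ for all large $i$, for some $(x_i)\in\xi$, and of the $\eta\in\partial_G\Omega$ such that $(x_i|y_j)_o\ge R$ for all large $i,j$, for some $(x_i)\in\xi$, $(y_j)\in\eta$; a set is open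 if with each of its points it contains a basic neighbourhood of that point. Theorem. Let $\Omega\subset\mathbb C^d$ be a bounded domain. The following are equivalent: (1) $\Omega$ is complete hyperbolic and visible, and $(\Omega,K_\Omega)$ is Gromov hyperbolic; (2) $\Omega$ is locally Gromov hyperbolic and locally visible at every $p\in\partial\Omega$. Moreover, if (1) or (2) (hence both) holds, then for every base point $o\in\Omega$ the identity map of $\Omega$ extends to a continuous surjective map $\overline\Omega^G\to\overline\Omega$ onto the Euclidean closure of $\Omega$. -/

import Mathlib

open Set Filter Topology

noncomputable section

/-! ### The Kobayashi pseudodistance -/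

/-- The Poincaré distance of the unit disc `{ζ : |ζ| < 1}`, normalized so that its infinitesimal
form is `|dζ| / (1 - |ζ|²)`. -/
def poincareDist (a b : ℂ) : ℝ :=
  Real.artanh ‖(a - b) / (1 - (starRingEnd ℂ) b * a)‖

/-- `DiscChain Ω z w L`: there is a finite chain of holomorphic discs in `Ω` that joins `z` to `w`
and has total Poincaré length `L`. -/
inductive DiscChain {d : ℕ} (Ω : Set (EuclideanSpace ℂ (Fin d))) :
    EuclideanSpace ℂ (Fin d) → EuclideanSpace ℂ (Fin d) → ℝ → Prop
  | nil (z : EuclideanSpace ℂ (Fin d)) (hz : z ∈ Ω) : DiscChain Ω z z 0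
  | cons (f : ℂ → EuclideanSpace ℂ (Fin d)) (a b : ℂ) (w : EuclideanSpace ℂ (Fin d)) (L : ℝ)
      (hf : DifferentiableOn ℂ f (Metric.ball 0 1))
      (hfΩ : MapsTo f (Metric.ball 0 1) Ω)
      (ha : a ∈ Metric.ball (0 : ℂ) 1) (hb : b ∈ Metric.ball (0 : ℂ) 1)
      (h : DiscChain Ω (f b) w L) :
      DiscChain Ω (f a) w (poincareDist a b + L)

/-- The Kobayashi pseudodistance `K_Ω` of a domain `Ω ⊆ ℂ^d`: the infimum of the lengths of the
chains of holomorphic discs from `z` to `w`. (For `Ω` open and connected and `z, w ∈ Ω` such chains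
exist.) -/
def kobayashiDist {d : ℕ} (Ω : Set (EuclideanSpace ℂ (Fin d)))
    (z w : EuclideanSpace ℂ (Fin d)) : ℝ :=
  sInf {L : ℝ | DiscChain Ω z w L}

/-! ### Metric notions, for a distance function `dist` on a set `S` -/

/-- `G` is a geodesic segment of `(S, dist)` with endpoints `x` and `y`: the image of an isometric
embedding of a compact interval. -/
def IsGeodesicSegment {X : Type*} (S : Set X) (dist : X → X → ℝ) (x y : X) (G : Set X) : Prop :=
  ∃ (L : ℝ) (γ : ℝ → X), 0 ≤ L ∧ γ 0 = x ∧ γ L = y ∧ (∀ t ∈ Icc 0 L, γ t ∈ S) ∧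
    (∀ s ∈ Icc 0 L, ∀ t ∈ Icc 0 L, dist (γ s) (γ t) = |s - t|) ∧ G = γ '' Icc 0 L

/-- `(S, dist)` is a geodesic space all of whose geodesic triangles are `δ`-thin, for one `δ`.
(That the other two sides satisfy the same condition is obtained by permuting the vertices.) -/
def IsGromovHyperbolic {X : Type*} (S : Set X) (dist : X → X → ℝ) : Prop :=
  (∀ x ∈ S, ∀ y ∈ S, ∃ G, IsGeodesicSegment S dist x y G) ∧
  ∃ δ : ℝ, 0 < δ ∧ ∀ x ∈ S, ∀ y ∈ S, ∀ z ∈ S, ∀ G₁ G₂ G₃ : Set X,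
    IsGeodesicSegment S dist x y G₁ → IsGeodesicSegment S dist y z G₂ →
    IsGeodesicSegment S dist z x G₃ →
    ∀ a ∈ G₁, ∃ b ∈ G₂ ∪ G₃, dist a b ≤ δ

/-- The pseudodistance `dist` separates the points of `S`, and every Cauchy sequence of
`(S, dist)` converges in `(S, dist)`. -/
def IsCompleteDist {X : Type*} (S : Set X) (dist : X → X → ℝ) : Prop :=
  (∀ x ∈ S, ∀ y ∈ S, dist x y = 0 → x = y) ∧
  ∀ u : ℕ → X, (∀ n, u n ∈ S) →
    (∀ ε : ℝ, 0 < ε → ∃ N, ∀ m ≥ N, ∀ n ≥ N, dist (u m) (u n) < ε) →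
    ∃ x ∈ S, Tendsto (fun n => dist (u n) x) atTop (𝓝 0)

/-! ### The Gromov compactification -/

/-- The Gromov product `(x | y)_o`. -/
def gromovProd {X : Type*} (dist : X → X → ℝ) (o x y : X) : ℝ :=
  (dist x o + dist y o - dist x y) / 2

/-- Sequences in `S` that converge at infinity: `(x_i | x_j)_o → ∞` as `i, j → ∞`. -/
def GromovSeq {X : Type*} (S : Set X) (dist : X → X → ℝ) (o : X) : Type _ :=
  {x : ℕ → X // (∀ n, x n ∈ S) ∧
    Tendsto (fun ij : ℕ × ℕ => gromovProd dist o (x ij.1) (x ij.2)) atTop atTop}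

/-- Two sequences converging at infinity are equivalent if `(x_i | y_j)_o → ∞` as `i, j → ∞`.
This is an equivalence relation when `(S, dist)` is Gromov hyperbolic. -/
def GromovSeq.Equivalent {X : Type*} {S : Set X} {dist : X → X → ℝ} {o : X}
    (x y : GromovSeq S dist o) : Prop :=
  Tendsto (fun ij : ℕ × ℕ => gromovProd dist o (x.1 ij.1) (y.1 ij.2)) atTop atTop

/-- The Gromov boundary: equivalence classes of sequences that converge at infinity. -/
def GromovBoundary {X : Type*} (S : Set X) (dist : X → X → ℝ) (o : X) : Type _ :=
  Quot (GromovSeq.Equivalent (S := S) (dist := dist) (o := o))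

/-- The underlying set of the Gromov compactification: `S` together with its Gromov boundary. -/
inductive GromovClosure {X : Type*} (S : Set X) (dist : X → X → ℝ) (o : X) : Type _
  | inner (z : S) : GromovClosure S dist o
  | bdry (ξ : GromovBoundary S dist o) : GromovClosure S dist o

/-- The basic neighbourhoods in the Gromov topology. For `z ∈ S`, the open ball of radius `1 / R`
around `z`; for a boundary point `ξ`, the points `y` of `S` with `(x_i | y)_o ≥ R` for all large
`i`, for some sequence `x` in the class `ξ`, together with the boundary points `η` such that
`(x_i | y_j)_o ≥ R` for all large `i, j`, for some `x` in `ξ` and `y` in `η`. -/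
def GromovClosure.basicNhd {X : Type*} {S : Set X} {dist : X → X → ℝ} {o : X} :
    GromovClosure S dist o → ℝ → Set (GromovClosure S dist o)
  | .inner z, R => {p | ∃ y : S, p = .inner y ∧ dist z.1 y.1 < 1 / R}
  | .bdry ξ, R =>
      {p | ∃ y : S, p = .inner y ∧ ∃ x : GromovSeq S dist o, Quot.mk _ x = ξ ∧
        ∀ᶠ i in atTop, R ≤ gromovProd dist o (x.1 i) y.1} ∪
      {p | ∃ η : GromovBoundary S dist o, p = .bdry η ∧
        ∃ x y : GromovSeq S dist o, Quot.mk _ x = ξ ∧ Quot.mk _ y = η ∧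
          ∀ᶠ ij : ℕ × ℕ in atTop, R ≤ gromovProd dist o (x.1 ij.1) (y.1 ij.2)}

theorem GromovClosure.basicNhd_anti {X : Type*} {S : Set X} {dist : X → X → ℝ} {o : X}
    (p : GromovClosure S dist o) {R R' : ℝ} (hR : 0 < R) (h : R ≤ R') :
    p.basicNhd R' ⊆ p.basicNhd R := by
  cases p with
  | inner z =>
    rintro _ ⟨y, rfl, hy⟩
    exact ⟨y, rfl, hy.trans_le (one_div_le_one_div_of_le hR h)⟩
  | bdry ξ =>
    rintro _ (⟨y, rfl, x, hx, hxy⟩ | ⟨η, rfl, x, y, hx, hy, hxy⟩)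
    · exact Or.inl ⟨y, rfl, x, hx, hxy.mono fun _ hi => h.trans hi⟩
    · exact Or.inr ⟨η, rfl, x, y, hx, hy, hxy.mono fun _ hi => h.trans hi⟩

/-- The Gromov topology: a set is open if with every point it contains one of the basic
neighbourhoods of that point. -/
instance {X : Type*} (S : Set X) (dist : X → X → ℝ) (o : X) :
    TopologicalSpace (GromovClosure S dist o) where
  IsOpen A := ∀ p ∈ A, ∃ R : ℝ, 0 < R ∧ p.basicNhd R ⊆ A
  isOpen_univ := fun _ _ => ⟨1, one_pos, subset_univ _⟩
  isOpen_inter := by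
    rintro A B hA hB p ⟨hpA, hpB⟩
    obtain ⟨R, hR, h⟩ := hA p hpA
    obtain ⟨R', _, h'⟩ := hB p hpB
    have hm : 0 < max R R' := lt_max_of_lt_left hR
    exact ⟨max R R', hm, subset_inter
      ((p.basicNhd_anti hR (le_max_left _ _)).trans h)
      ((p.basicNhd_anti (by assumption) (le_max_right _ _)).trans h')⟩
  isOpen_sUnion := by
    rintro 𝒜 h𝒜 p ⟨A, hA, hp⟩
    obtain ⟨R, hR, h⟩ := h𝒜 A hA p hp
    exact ⟨R, hR, h.trans (subset_sUnion_of_mem hA)⟩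

/-! ### Visibility and its local version -/

/-- `Ω` is complete hyperbolic: `(Ω, K_Ω)` is a complete metric space. -/
def IsCompleteHyperbolic {d : ℕ} (Ω : Set (EuclideanSpace ℂ (Fin d))) : Prop :=
  IsCompleteDist Ω (kobayashiDist Ω)

/-- The couple `(p, q)` of boundary points has the visibility condition with respect to the
geodesics for `K_D`. -/
def VisibilityCondition {d : ℕ} (D : Set (EuclideanSpace ℂ (Fin d)))
    (p q : EuclideanSpace ℂ (Fin d)) : Prop :=
  ∃ Vp ∈ 𝓝 p, ∃ Vq ∈ 𝓝 q, ∃ K : Set (EuclideanSpace ℂ (Fin d)),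
    IsCompact K ∧ K ⊆ D ∧ Disjoint Vp Vq ∧
    ∀ x ∈ Vp ∩ D, ∀ y ∈ Vq ∩ D, ∀ G, IsGeodesicSegment D (kobayashiDist D) x y G →
      (G ∩ K).Nonempty

/-- Every couple of distinct points of `∂Ω` has the visibility condition. -/
def IsVisibleDomain {d : ℕ} (Ω : Set (EuclideanSpace ℂ (Fin d))) : Prop :=
  ∀ p ∈ frontier Ω, ∀ q ∈ frontier Ω, p ≠ q → VisibilityCondition Ω p q

/-- `Ω` is locally Gromov hyperbolic at `p`. -/
def IsLocallyGromovHyperbolicAt {d : ℕ} (Ω : Set (EuclideanSpace ℂ (Fin d)))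
    (p : EuclideanSpace ℂ (Fin d)) : Prop :=
  ∃ U : Set (EuclideanSpace ℂ (Fin d)), IsOpen U ∧ p ∈ U ∧ IsConnected (Ω ∩ U) ∧
    IsCompleteHyperbolic (Ω ∩ U) ∧ IsGromovHyperbolic (Ω ∩ U) (kobayashiDist (Ω ∩ U))

/-- `Ω` is locally visible at `p`. -/
def IsLocallyVisibleAt {d : ℕ} (Ω : Set (EuclideanSpace ℂ (Fin d)))
    (p : EuclideanSpace ℂ (Fin d)) : Prop :=
  ∃ V : Set (EuclideanSpace ℂ (Fin d)), IsOpen V ∧ p ∈ V ∧ IsConnected (Ω ∩ V) ∧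
    IsCompleteHyperbolic (Ω ∩ V) ∧
    ∃ V' : Set (EuclideanSpace ℂ (Fin d)), IsOpen V' ∧ p ∈ V' ∧ V' ⊆ V ∧
      ∀ q₁ ∈ frontier Ω ∩ V', ∀ q₂ ∈ frontier Ω ∩ V', q₁ ≠ q₂ →
        VisibilityCondition (Ω ∩ V) q₁ q₂

/-- Condition (1): `Ω` is visible and `(Ω, K_Ω)` is Gromov hyperbolic. Both notions are defined
for complete hyperbolic domains, so that complete hyperbolicity is part of the condition. -/
def IsVisibleAndGromovHyperbolic {d : ℕ} (Ω : Set (EuclideanSpace ℂ (Fin d))) : Prop :=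
  IsCompleteHyperbolic Ω ∧ IsVisibleDomain Ω ∧ IsGromovHyperbolic Ω (kobayashiDist Ω)

/-- Condition (2): `Ω` is locally Gromov hyperbolic and locally visible, at every boundary
point. -/
def IsLocallyVisibleAndGromovHyperbolic {d : ℕ} (Ω : Set (EuclideanSpace ℂ (Fin d))) : Prop :=
  (∀ p ∈ frontier Ω, IsLocallyGromovHyperbolicAt Ω p) ∧
  (∀ p ∈ frontier Ω, IsLocallyVisibleAt Ω p)

end

noncomputable section

/-! ### The Poincaré distance -/

/-! Everything goes through one quantitative form of visibility, `HasBoundedProducts`: Gromov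
products of points at Euclidean distance at least `ε` are bounded. Visibility implies it, since a
product is at most the distance from `o` to any point of a geodesic, and visible geodesics meet a
fixed compact set. Conversely, in a hyperbolic space a geodesic comes within a bounded distance of
its endpoints' product to `o`, and closed Kobayashi balls are compact by Hopf–Rinow, so bounded
products give visibility.

The implication from global to local is trivial: take all of `ℂ^d` as the neighbourhood. The
converse is a localization argument. If `z` has Kobayashi distance `R` from `Ω \ U`, a disc of `Ω`
centred at `z` maps the concentric disc of radius `tanh R` into `U`; hence `K_{Ω∩U}(z,w) ≤ h / tanh
(R - h)` with `h = K_Ω(z,w) < R` (`kobayashiDist_inter_le`). Local completeness at the boundary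
therefore gives completeness of `Ω`. Near `p`, a crude Euclidean value of `R` gives a multiplicative
comparison along geodesics; with bounded products in `Ω ∩ V` this yields `K_Ω(z, w) ≥ c K_Ω(z, o) -
C` for `z` near `p` and `w` far from `p`. Used as a new value of `R`, this bound makes the relative
error `coth R - 1` decay exponentially along a geodesic, because the distance to `o` grows at least
at half speed away from the point nearest to `o`. The error is summable, and the comparison of
`K_{Ω∩U}` with `K_Ω` becomes additive (`exists_kobayashiDist_inter_le_of_geodesic`).

Consequently a geodesic that leaves a ball around `p` has an exit point at bounded excess from `o`
(`exists_exit_point`). This bounds products globally, and it makes `K_{Ω∩U}` and `K_Ω` agree near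
`p` up to a constant. The four-point condition of `Ω ∩ U` then passes to triples of `Ω` near `p`.
For a middle point near `p` and another point far from it, bounded products make the condition
trivial, and compactness of `closure Ω` concludes.

For the extension, bounded products turn sequences converging at infinity into Euclidean Cauchy
sequences, with equal limits for equivalent ones; the same estimate gives continuity. Surjectivity
comes from a diagonal choice along geodesics from `o` to points tending to a given boundary point.
-/

theorem Real.artanh_le_div_one_sub {x : ℝ} (h0 : 0 ≤ x) (h1 : x < 1) :
    Real.artanh x ≤ x / (1 - x) := by
  rw [Real.artanh_eq_half_log ⟨by linarith, h1.le⟩,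
    Real.log_div (by linarith) (by linarith)]
  have h2 : Real.log (1 + x) ≤ x := by
    have := Real.log_le_sub_one_of_pos (show 0 < 1 + x by linarith)
    linarith
  have h3 : -Real.log (1 - x) ≤ x / (1 - x) := by
    have := Real.log_le_sub_one_of_pos (show 0 < (1 - x)⁻¹ from inv_pos.2 (by linarith))
    rw [Real.log_inv] at this
    refine this.trans (le_of_eq ?_)
    have : 1 - x ≠ 0 := by linarith
    field_simp
    ring
  have h4 : x ≤ x / (1 - x) := by
    rw [le_div_iff₀ (by linarith)]
    nlinarith
  linarith

theorem Real.self_le_artanh {x : ℝ} (h0 : 0 ≤ x) (h1 : x < 1) : x ≤ Real.artanh x := by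
  rw [Real.artanh_eq_half_log ⟨by linarith, h1.le⟩, Real.log_div (by linarith) (by linarith)]
  have hs := Real.hasSum_log_sub_log_of_abs_lt_one (x := x) (by rwa [abs_of_nonneg h0])
  have := le_hasSum hs 0 fun j _ => by positivity
  simp at this
  linarith

theorem Real.tanh_nonneg {t : ℝ} (ht : 0 ≤ t) : 0 ≤ Real.tanh t := by
  rw [Real.tanh_eq_sinh_div_cosh]
  exact div_nonneg (Real.sinh_nonneg_iff.2 ht) (Real.cosh_pos t).le

theorem Real.tanh_pos {t : ℝ} (ht : 0 < t) : 0 < Real.tanh t := by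
  rw [Real.tanh_eq_sinh_div_cosh]
  exact div_pos (Real.sinh_pos_iff.2 ht) (Real.cosh_pos t)

theorem Real.tanh_le_self {t : ℝ} (ht : 0 ≤ t) : Real.tanh t ≤ t := by
  have := Real.self_le_artanh (Real.tanh_nonneg ht) (Real.tanh_lt_one t)
  rwa [Real.artanh_tanh] at this

theorem Real.tanh_sub_eq (s t : ℝ) :
    Real.tanh (s - t) = (Real.tanh s - Real.tanh t) / (1 - Real.tanh t * Real.tanh s) := by
  have hs := (Real.cosh_pos s).ne'
  have ht := (Real.cosh_pos t).ne'
  have hst := (Real.cosh_pos (s - t)).ne'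
  have h1 : 1 - Real.tanh t * Real.tanh s ≠ 0 := by
    have h1 := abs_lt.1 (Real.abs_tanh_lt_one s)
    have h2 := abs_lt.1 (Real.abs_tanh_lt_one t)
    nlinarith
  rw [eq_div_iff h1]
  simp only [Real.tanh_eq_sinh_div_cosh]
  rw [Real.cosh_sub, mul_comm (Real.cosh s)] at hst
  rw [Real.sinh_sub, Real.cosh_sub]
  field_simp

theorem tanh_mem_ball (t : ℝ) : (Real.tanh t : ℂ) ∈ Metric.ball (0 : ℂ) 1 := by
  rw [mem_ball_zero_iff, Complex.norm_real, Real.norm_eq_abs]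
  exact Real.abs_tanh_lt_one t

/-- The subtraction formula for `tanh` has the shape of the Möbius quotient in `poincareDist`, so
`tanh` parametrizes the real diameter by arc length. -/
theorem poincareDist_tanh (s t : ℝ) : poincareDist (Real.tanh s) (Real.tanh t) = |s - t| := by
  have h : ((Real.tanh s : ℂ) - Real.tanh t) /
      (1 - (starRingEnd ℂ) (Real.tanh t : ℂ) * Real.tanh s) = (Real.tanh (s - t) : ℝ) := by
    rw [Real.tanh_sub_eq, Complex.conj_ofReal]
    push_cast
    rfl
  rw [poincareDist, h, Complex.norm_real, Real.norm_eq_abs]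
  rcases abs_cases (s - t) with ⟨h1, h2⟩ | ⟨h1, h2⟩
  · rw [h1, abs_of_nonneg (Real.tanh_nonneg h2), Real.artanh_tanh]
  · rw [h1, abs_of_nonpos, ← Real.tanh_neg, Real.artanh_tanh]
    have := Real.tanh_nonneg (t := -(s - t)) (by linarith)
    rw [Real.tanh_neg] at this
    linarith

theorem poincareDist_nonneg (a b : ℂ) : 0 ≤ poincareDist a b :=
  Real.artanh_nonneg (norm_nonneg _)

theorem poincareDist_comm (a b : ℂ) : poincareDist a b = poincareDist b a := by
  have h : ‖1 - (starRingEnd ℂ) b * a‖ = ‖1 - (starRingEnd ℂ) a * b‖ := by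
    rw [← Complex.norm_conj (1 - (starRingEnd ℂ) b * a)]
    simp [mul_comm]
  rw [poincareDist, poincareDist, norm_div, norm_div, norm_sub_rev, h]

theorem poincareDist_zero_left (b : ℂ) : poincareDist 0 b = Real.artanh ‖b‖ := by
  simp [poincareDist]

/-- The difference of the squares is `(1 - |a|²)(1 - |z|²)`, which is positive. -/
theorem Complex.norm_add_lt_norm_one_add_conj_mul {a z : ℂ} (ha : ‖a‖ < 1) (hz : ‖z‖ < 1) :
    ‖z + a‖ < ‖1 + (starRingEnd ℂ) a * z‖ := by
  rw [← sq_lt_sq₀ (norm_nonneg _) (norm_nonneg _), ← Complex.normSq_eq_norm_sq,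
    ← Complex.normSq_eq_norm_sq]
  have h1 : Complex.normSq a < 1 := by
    rw [Complex.normSq_eq_norm_sq]; nlinarith [norm_nonneg a]
  have h2 : Complex.normSq z < 1 := by
    rw [Complex.normSq_eq_norm_sq]; nlinarith [norm_nonneg z]
  simp only [Complex.normSq_apply, Complex.add_re, Complex.add_im, Complex.mul_re,
    Complex.mul_im, Complex.conj_re, Complex.conj_im, Complex.one_re, Complex.one_im] at *
  nlinarith [mul_pos (sub_pos.2 h1) (sub_pos.2 h2)]

/-- A holomorphic disc can be reparametrized so that two given points become the images of `0`
and of a point of `[0, 1)`. -/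
theorem exists_disc_reparam {F : Type*} [NormedAddCommGroup F] [NormedSpace ℂ F] {f : ℂ → F}
    {S : Set F} (hf : DifferentiableOn ℂ f (Metric.ball 0 1))
    (hfS : MapsTo f (Metric.ball 0 1) S) {a b : ℂ} (ha : a ∈ Metric.ball (0 : ℂ) 1)
    (hb : b ∈ Metric.ball (0 : ℂ) 1) :
    ∃ g : ℂ → F, DifferentiableOn ℂ g (Metric.ball 0 1) ∧ MapsTo g (Metric.ball 0 1) S ∧
      g 0 = f a ∧ g (Real.tanh (poincareDist a b) : ℝ) = f b := by
  rw [mem_ball_zero_iff] at ha hb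
  set w : ℂ := (b - a) / (1 - (starRingEnd ℂ) a * b) with hw
  have hden : ∀ z : ℂ, ‖z‖ < 1 → 1 + (starRingEnd ℂ) a * z ≠ 0 := fun z hz h => by
    have := Complex.norm_add_lt_norm_one_add_conj_mul ha hz
    rw [h, norm_zero] at this
    exact absurd this (not_lt.2 (norm_nonneg _))
  have hden' : 1 - (starRingEnd ℂ) a * b ≠ 0 := by
    have := hden (-b) (by rwa [norm_neg])
    rwa [mul_neg, ← sub_eq_add_neg] at this
  have hwn : ‖w‖ < 1 := by
    have := Complex.norm_add_lt_norm_one_add_conj_mul (a := -a) (z := b) (by rwa [norm_neg]) hb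
    rw [map_neg, neg_mul, ← sub_eq_add_neg, ← sub_eq_add_neg] at this
    rw [hw, norm_div, div_lt_one (norm_pos_iff.2 hden')]
    exact this
  have htanh : Real.tanh (poincareDist a b) = ‖w‖ := by
    rw [poincareDist_comm, poincareDist, Real.tanh_artanh ⟨by linarith [norm_nonneg w], hwn⟩]
  -- Precomposition with the rotation by `u` brings `w`, the Möbius image of `b`, to the real point
  -- `‖w‖`. When `w = 0` any rotation does.
  obtain ⟨u, hu, hwu⟩ : ∃ u : ℂ, ‖u‖ = 1 ∧ u * (‖w‖ : ℂ) = w := by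
    by_cases h : w = 0
    · exact ⟨1, by simp, by simp [h]⟩
    · have h' : (‖w‖ : ℂ) ≠ 0 := by exact_mod_cast (norm_ne_zero_iff.2 h)
      exact ⟨w / ‖w‖, by rw [norm_div, Complex.norm_real, norm_norm, div_self (by simpa using h)],
        div_mul_cancel₀ _ h'⟩
  have hball : ∀ z ∈ Metric.ball (0 : ℂ) 1, ‖u * z‖ < 1 := fun z hz => by
    rw [norm_mul, hu, one_mul]; simpa using hz
  have hmap : MapsTo (fun z : ℂ => (u * z + a) / (1 + (starRingEnd ℂ) a * (u * z)))
      (Metric.ball 0 1) (Metric.ball 0 1) := fun z hz => by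
    rw [mem_ball_zero_iff, norm_div, div_lt_one (norm_pos_iff.2 (hden _ (hball z hz)))]
    exact Complex.norm_add_lt_norm_one_add_conj_mul ha (hball z hz)
  refine ⟨f ∘ fun z : ℂ => (u * z + a) / (1 + (starRingEnd ℂ) a * (u * z)), ?_, ?_, ?_, ?_⟩
  · refine hf.comp (DifferentiableOn.div (by fun_prop) (by fun_prop) fun z hz => ?_) hmap
    exact hden _ (hball z hz)
  · exact hfS.comp hmap
  · simp
  · simp only [Function.comp, htanh, hwu]
    congr 1
    rw [div_eq_iff (hden w hwn), hw]
    generalize (starRingEnd ℂ) a = c at hden'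
    rw [mul_comm] at hden'
    field_simp
    ring

/-! ### Chains of discs -/

variable {d : ℕ} {Ω : Set (EuclideanSpace ℂ (Fin d))}

theorem DiscChain.left_mem {z w : EuclideanSpace ℂ (Fin d)} {L : ℝ} (h : DiscChain Ω z w L) :
    z ∈ Ω := by
  cases h with
  | nil _ hz => exact hz
  | cons f a b w L hf hfΩ ha hb h => exact hfΩ ha

theorem DiscChain.right_mem {z w : EuclideanSpace ℂ (Fin d)} {L : ℝ} (h : DiscChain Ω z w L) :
    w ∈ Ω := by
  induction h with
  | nil _ hz => exact hz
  | cons f a b w L hf hfΩ ha hb h ih => exact ih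

theorem DiscChain.length_nonneg {z w : EuclideanSpace ℂ (Fin d)} {L : ℝ}
    (h : DiscChain Ω z w L) : 0 ≤ L := by
  induction h with
  | nil _ hz => exact le_rfl
  | cons f a b w L hf hfΩ ha hb h ih => exact add_nonneg (poincareDist_nonneg _ _) ih

theorem DiscChain.trans {z m w : EuclideanSpace ℂ (Fin d)} {L L' : ℝ}
    (h : DiscChain Ω z m L) (h' : DiscChain Ω m w L') : DiscChain Ω z w (L + L') := by
  induction h with
  | nil _ hz => rwa [zero_add]
  | cons f a b w L hf hfΩ ha hb h ih =>
    rw [add_assoc]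
    exact DiscChain.cons f a b _ _ hf hfΩ ha hb (ih h')

theorem DiscChain.of_disc {f : ℂ → EuclideanSpace ℂ (Fin d)} {a b : ℂ}
    (hf : DifferentiableOn ℂ f (Metric.ball 0 1)) (hfΩ : MapsTo f (Metric.ball 0 1) Ω)
    (ha : a ∈ Metric.ball (0 : ℂ) 1) (hb : b ∈ Metric.ball (0 : ℂ) 1) :
    DiscChain Ω (f a) (f b) (poincareDist a b) := by
  simpa using DiscChain.cons f a b _ 0 hf hfΩ ha hb (DiscChain.nil _ (hfΩ hb))

theorem DiscChain.symm {z w : EuclideanSpace ℂ (Fin d)} {L : ℝ} (h : DiscChain Ω z w L) :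
    DiscChain Ω w z L := by
  induction h with
  | nil z hz => exact DiscChain.nil z hz
  | cons f a b w L hf hfΩ ha hb h ih =>
    rw [add_comm, poincareDist_comm]
    exact ih.trans (DiscChain.of_disc hf hfΩ hb ha)

theorem DiscChain.of_disc_tanh {f : ℂ → EuclideanSpace ℂ (Fin d)}
    (hf : DifferentiableOn ℂ f (Metric.ball 0 1)) (hfΩ : MapsTo f (Metric.ball 0 1) Ω)
    (s t : ℝ) : DiscChain Ω (f (Real.tanh s)) (f (Real.tanh t)) |s - t| := by
  rw [← poincareDist_tanh]
  exact DiscChain.of_disc hf hfΩ (tanh_mem_ball s) (tanh_mem_ball t)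

/-- Induction on chains whose discs are normalized to join the images of `0` and `tanh ℓ`. -/
theorem DiscChain.normalized_induction
    {P : EuclideanSpace ℂ (Fin d) → EuclideanSpace ℂ (Fin d) → ℝ → Prop}
    (nil : ∀ z ∈ Ω, P z z 0)
    (cons : ∀ (f : ℂ → EuclideanSpace ℂ (Fin d)) (l : ℝ) (w : EuclideanSpace ℂ (Fin d)) (L : ℝ),
      0 ≤ l → DifferentiableOn ℂ f (Metric.ball 0 1) → MapsTo f (Metric.ball 0 1) Ω →
      DiscChain Ω (f (Real.tanh l)) w L → P (f (Real.tanh l)) w L → P (f 0) w (l + L))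
    {z w : EuclideanSpace ℂ (Fin d)} {L : ℝ} (h : DiscChain Ω z w L) : P z w L := by
  induction h with
  | nil z hz => exact nil z hz
  | cons f a b w L hf hfΩ ha hb h ih =>
    obtain ⟨g, hg, hgΩ, h0, h1⟩ := exists_disc_reparam hf hfΩ ha hb
    rw [← h0]
    rw [← h1] at ih h
    exact cons g _ w L (poincareDist_nonneg _ _) hg hgΩ h ih

/-- A chain of discs of length `L` contains a curve that is parametrized by `[0, L]` and is
`1`-Lipschitz for the length of chains. -/
theorem DiscChain.exists_curve {z w : EuclideanSpace ℂ (Fin d)} {L : ℝ}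
    (h : DiscChain Ω z w L) :
    ∃ γ : ℝ → EuclideanSpace ℂ (Fin d), γ 0 = z ∧ γ L = w ∧
      ∀ s t, 0 ≤ s → s ≤ t → t ≤ L → DiscChain Ω (γ s) (γ t) (t - s) := by
  refine h.normalized_induction (P := fun z w L => ∃ γ : ℝ → EuclideanSpace ℂ (Fin d),
    γ 0 = z ∧ γ L = w ∧ ∀ s t, 0 ≤ s → s ≤ t → t ≤ L → DiscChain Ω (γ s) (γ t) (t - s)) ?_ ?_
  · intro z hz
    refine ⟨fun _ => z, rfl, rfl, fun s t h0 h1 h2 => ?_⟩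
    have : t - s = 0 := by linarith
    rw [this]
    exact DiscChain.nil z hz
  · rintro f l w L hl hf hfΩ hch ⟨γ, h0, h1, h2⟩
    have hL := hch.length_nonneg
    refine ⟨fun t => if t ≤ l then f (Real.tanh t) else γ (t - l), ?_, ?_, ?_⟩
    · simp [hl]
    -- The endpoint falls into the branch of the first disc only if `L = 0`, where the two pieces
    -- meet.
    · by_cases h : l + L ≤ l
      · have : L = 0 := by linarith
        subst this
        simp only [add_zero, le_refl, if_true]
        rw [← h0, h1]
      · simp [h1] at h ⊢
        intro h'
        linarith
    · intro s t hs hst htL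
      have hd : ∀ s t, s ≤ t → DiscChain Ω (f (Real.tanh s)) (f (Real.tanh t)) (t - s) :=
        fun s t hst => by
          have := DiscChain.of_disc_tanh hf hfΩ s t
          rwa [abs_sub_comm, abs_of_nonneg (by linarith)] at this
      by_cases h : t ≤ l
      · simpa [h, hst.trans h] using hd s t hst
      · by_cases h' : s ≤ l
        · have e : t - s = (l - s) + ((t - l) - 0) := by ring
          simp only [h, h', if_true, if_false]
          rw [e]
          refine (hd s l h').trans ?_
          rw [← h0]
          exact h2 0 (t - l) le_rfl (by linarith) (by linarith)
        · have e : t - s = (t - l) - (s - l) := by ring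
          simp only [h, h', if_false]
          rw [e]
          exact h2 _ _ (by linarith) (by linarith) (by linarith)

end

noncomputable section

/-! ### Pseudodistances on a set -/

/-- `dist` restricts to a pseudodistance on `S`. -/
structure IsDistOn {X : Type*} (S : Set X) (dist : X → X → ℝ) : Prop where
  self : ∀ x ∈ S, dist x x = 0
  symm : ∀ x ∈ S, ∀ y ∈ S, dist x y = dist y x
  triangle : ∀ x ∈ S, ∀ y ∈ S, ∀ z ∈ S, dist x z ≤ dist x y + dist y z

theorem IsDistOn.nonneg {X : Type*} {S : Set X} {dist : X → X → ℝ} (h : IsDistOn S dist)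
    {x y : X} (hx : x ∈ S) (hy : y ∈ S) : 0 ≤ dist x y := by
  have h1 := h.triangle x hx y hy x hx
  rw [h.self x hx, h.symm y hy x hx] at h1
  linarith

theorem IsDistOn.abs_sub_le {X : Type*} {S : Set X} {dist : X → X → ℝ} (h : IsDistOn S dist)
    {x y z : X} (hx : x ∈ S) (hy : y ∈ S) (hz : z ∈ S) : |dist x z - dist y z| ≤ dist x y := by
  have h1 := h.triangle x hx y hy z hz
  have h2 := h.triangle y hy x hx z hz
  rw [h.symm y hy x hx] at h2
  exact abs_le.2 ⟨by linarith, by linarith⟩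

/-! ### Basic properties of the Kobayashi distance -/

variable {d : ℕ} {Ω D : Set (EuclideanSpace ℂ (Fin d))}

theorem DiscChain.mono (h : D ⊆ Ω) {z w : EuclideanSpace ℂ (Fin d)} {L : ℝ}
    (hc : DiscChain D z w L) : DiscChain Ω z w L := by
  induction hc with
  | nil z hz => exact DiscChain.nil z (h hz)
  | cons f a b w L hf hfΩ ha hb _ ih =>
    exact DiscChain.cons f a b w L hf (hfΩ.mono_right h) ha hb ih

theorem DiscChain.kobayashiDist_le {z w : EuclideanSpace ℂ (Fin d)} {L : ℝ}
    (h : DiscChain Ω z w L) : kobayashiDist Ω z w ≤ L :=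
  csInf_le ⟨0, fun _ h => DiscChain.length_nonneg h⟩ h

/-- The affine disc `ζ ↦ z + ζ v` with `‖v‖ = r`, in the direction of `w`, stays in the ball and
reaches `w` at `ζ = dist w z / r`. -/
theorem DiscChain.of_ball {z w : EuclideanSpace ℂ (Fin d)} {r : ℝ}
    (hr : Metric.ball z r ⊆ Ω) (hw : w ∈ Metric.ball z r) :
    DiscChain Ω z w (Real.artanh (dist w z / r)) := by
  have hr0 : 0 < r := Metric.pos_of_mem_ball hw
  by_cases hzw : w = z
  · subst hzw
    simpa using DiscChain.nil w (hr hw)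
  have hn : dist w z ≠ 0 := dist_ne_zero.2 hzw
  have hn0 : 0 < dist w z := dist_pos.2 hzw
  set v : EuclideanSpace ℂ (Fin d) := ((r / dist w z : ℝ) : ℂ) • (w - z) with hv
  have hvn : ‖v‖ = r := by
    rw [hv, norm_smul, Complex.norm_real, Real.norm_of_nonneg (by positivity), ← dist_eq_norm,
      div_mul_cancel₀ _ hn]
  have hb : ((dist w z / r : ℝ) : ℂ) ∈ Metric.ball (0 : ℂ) 1 := by
    rw [mem_ball_zero_iff, Complex.norm_real, Real.norm_of_nonneg (by positivity), div_lt_one hr0]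
    exact hw
  have := DiscChain.of_disc (Ω := Ω) (f := fun ζ : ℂ => z + ζ • v) (a := 0) (by fun_prop)
    (fun ζ hζ => hr (by
      rw [mem_ball_zero_iff] at hζ
      rw [Metric.mem_ball, dist_eq_norm, add_sub_cancel_left, norm_smul, hvn]
      nlinarith)) (Metric.mem_ball_self one_pos) hb
  rw [poincareDist_zero_left, Complex.norm_real, Real.norm_of_nonneg (by positivity)] at this
  convert this using 1
  · simp
  · rw [hv, smul_smul, ← Complex.ofReal_mul, div_mul_div_comm, mul_comm r, div_self (by positivity)]
    simp

theorem exists_discChain (ho : IsOpen Ω) (hc : IsConnected Ω) {z w : EuclideanSpace ℂ (Fin d)}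
    (hz : z ∈ Ω) (hw : w ∈ Ω) : ∃ L, DiscChain Ω z w L := by
  refine hc.isPreconnected.induction₂ (fun z w => ∃ L, DiscChain Ω z w L) ?_ ?_ ?_ hz hw
  · intro x hx
    obtain ⟨r, hr, h⟩ := Metric.isOpen_iff.1 ho x hx
    filter_upwards [mem_nhdsWithin_of_mem_nhds (Metric.ball_mem_nhds x hr)] with y hy
    exact ⟨_, DiscChain.of_ball h hy⟩
  · rintro x y z _ _ _ ⟨L, h⟩ ⟨L', h'⟩
    exact ⟨_, h.trans h'⟩
  · rintro x y _ _ ⟨L, h⟩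
    exact ⟨_, h.symm⟩

theorem exists_discChain_lt (ho : IsOpen Ω) (hc : IsConnected Ω)
    {z w : EuclideanSpace ℂ (Fin d)} (hz : z ∈ Ω) (hw : w ∈ Ω) {R : ℝ}
    (hR : kobayashiDist Ω z w < R) : ∃ L < R, DiscChain Ω z w L := by
  obtain ⟨L, hL, h⟩ := exists_lt_of_csInf_lt (exists_discChain ho hc hz hw) hR
  exact ⟨L, h, hL⟩

theorem kobayashiDist_nonneg (z w : EuclideanSpace ℂ (Fin d)) : 0 ≤ kobayashiDist Ω z w :=
  Real.sInf_nonneg fun _ h => DiscChain.length_nonneg h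

theorem isDistOn_kobayashiDist (ho : IsOpen Ω) (hc : IsConnected Ω) :
    IsDistOn Ω (kobayashiDist Ω) where
  self x hx := le_antisymm (DiscChain.nil x hx).kobayashiDist_le (kobayashiDist_nonneg _ _)
  symm x _ y _ := by
    have : {L : ℝ | DiscChain Ω x y L} = {L : ℝ | DiscChain Ω y x L} :=
      Set.ext fun L => ⟨DiscChain.symm, DiscChain.symm⟩
    rw [kobayashiDist, kobayashiDist, this]
  triangle x hx y hy z hz := by
    refine le_of_forall_pos_le_add fun ε hε => ?_
    obtain ⟨L, hL, h⟩ := exists_discChain_lt ho hc hx hy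
      (R := kobayashiDist Ω x y + ε / 2) (by linarith)
    obtain ⟨L', hL', h'⟩ := exists_discChain_lt ho hc hy hz
      (R := kobayashiDist Ω y z + ε / 2) (by linarith)
    linarith [(h.trans h').kobayashiDist_le]

theorem kobayashiDist_anti (ho : IsOpen D) (hc : IsConnected D) (h : D ⊆ Ω)
    {z w : EuclideanSpace ℂ (Fin d)} (hz : z ∈ D) (hw : w ∈ D) :
    kobayashiDist Ω z w ≤ kobayashiDist D z w := by
  refine le_of_forall_pos_le_add fun ε hε => ?_
  obtain ⟨L, hL, hch⟩ := exists_discChain_lt ho hc hz hw (lt_add_of_pos_right _ hε)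
  exact (hch.mono h).kobayashiDist_le.trans hL.le

theorem kobayashiDist_le_of_ball {z w : EuclideanSpace ℂ (Fin d)} {r : ℝ} (hr0 : 0 < r)
    (hr : Metric.ball z r ⊆ Ω) (hw : dist w z ≤ r / 2) :
    kobayashiDist Ω z w ≤ 2 / r * dist w z := by
  have h0 : 0 ≤ dist w z / r := by positivity
  have h1 : dist w z / r ≤ 1 / 2 := by rw [div_le_iff₀ hr0]; linarith
  calc kobayashiDist Ω z w ≤ Real.artanh (dist w z / r) :=
        (DiscChain.of_ball hr (lt_of_le_of_lt hw (by linarith))).kobayashiDist_le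
    _ ≤ dist w z / r / (1 - dist w z / r) := Real.artanh_le_div_one_sub h0 (by linarith)
    _ ≤ dist w z / r / (1 / 2) := by gcongr; linarith
    _ = 2 / r * dist w z := by ring

theorem tendsto_kobayashiDist_nhds (ho : IsOpen Ω) {z : EuclideanSpace ℂ (Fin d)} (hz : z ∈ Ω) :
    Tendsto (fun w => kobayashiDist Ω z w) (𝓝 z) (𝓝 0) := by
  obtain ⟨r, hr, h⟩ := Metric.isOpen_iff.1 ho z hz
  refine squeeze_zero' (g := fun w => 2 / r * dist w z)
    (Eventually.of_forall fun w => kobayashiDist_nonneg _ _) ?_ ?_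
  · filter_upwards [Metric.closedBall_mem_nhds z (half_pos hr)] with w hw
    exact kobayashiDist_le_of_ball hr h hw
  · have : Tendsto (fun w => 2 / r * dist w z) (𝓝 z) (𝓝 (2 / r * dist z z)) :=
      (continuous_const.mul (continuous_id.dist continuous_const)).tendsto z
    simpa using this

theorem continuousOn_kobayashiDist (ho : IsOpen Ω) (hc : IsConnected Ω)
    {o : EuclideanSpace ℂ (Fin d)} (hoΩ : o ∈ Ω) :
    ContinuousOn (fun z => kobayashiDist Ω z o) Ω := by
  intro z hz
  rw [ContinuousWithinAt, tendsto_iff_dist_tendsto_zero]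
  refine squeeze_zero' (Eventually.of_forall fun w => dist_nonneg) ?_
    ((tendsto_kobayashiDist_nhds ho hz).mono_left nhdsWithin_le_nhds)
  filter_upwards [self_mem_nhdsWithin] with w hw
  rw [dist_comm, Real.dist_eq]
  exact (isDistOn_kobayashiDist ho hc).abs_sub_le hz hw hoΩ

/-- By the Schwarz lemma, a disc in a set of diameter less than `M` moves `0` and `tanh l` apart by
at most `M tanh l ≤ M l`; sum over a chain. -/
theorem exists_mul_dist_le_kobayashiDist (ho : IsOpen Ω) (hc : IsConnected Ω)
    (hb : Bornology.IsBounded Ω) : ∃ c : ℝ, 0 < c ∧ ∀ z ∈ Ω, ∀ w ∈ Ω,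
      c * dist z w ≤ kobayashiDist Ω z w := by
  obtain ⟨R, hR⟩ := Metric.isBounded_iff.1 hb
  set M := max R 0 + 1 with hM
  have hM0 : 0 < M := by positivity
  have hlt : ∀ z ∈ Ω, ∀ w ∈ Ω, dist z w < M := fun z hz w hw =>
    ((hR hz hw).trans (le_max_left _ _)).trans_lt (lt_add_one _)
  have key : ∀ z w L, DiscChain Ω z w L → dist z w ≤ M * L := by
    intro z w L h
    refine h.normalized_induction (P := fun z w L => dist z w ≤ M * L) (by simp) ?_
    intro f l w L hl hf hfΩ _ ih
    have h0 : (0 : ℂ) ∈ Metric.ball (0 : ℂ) 1 := Metric.mem_ball_self one_pos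
    have h1 := Complex.dist_le_div_mul_dist_of_mapsTo_ball hf (R₂ := M)
      (fun ζ hζ => (hlt _ (hfΩ hζ) _ (hfΩ h0)).le) (tanh_mem_ball l)
    rw [dist_zero_right, Complex.norm_real, Real.norm_of_nonneg (Real.tanh_nonneg hl), div_one,
      dist_comm] at h1
    have h2 := mul_le_mul_of_nonneg_left (Real.tanh_le_self hl) hM0.le
    linarith [dist_triangle (f 0) (f (Real.tanh l)) w]
  refine ⟨M⁻¹, inv_pos.2 hM0, fun z hz w hw => le_of_forall_pos_le_add fun ε hε => ?_⟩
  obtain ⟨L, hL, h⟩ := exists_discChain_lt ho hc hz hw (lt_add_of_pos_right _ hε)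
  rw [inv_mul_le_iff₀ hM0]
  exact (key z w L h).trans (mul_le_mul_of_nonneg_left hL.le hM0.le)

/-! ### Localization of the Kobayashi distance -/

variable {U : Set (EuclideanSpace ℂ (Fin d))}

/-- A disc whose centre is at distance at least `ρ` from the complement of `U` maps the Poincaré
ball of radius `ρ` into `U`. -/
theorem kobayashiDist_inter_le_of_disc {f : ℂ → EuclideanSpace ℂ (Fin d)}
    (hf : DifferentiableOn ℂ f (Metric.ball 0 1)) (hfΩ : MapsTo f (Metric.ball 0 1) Ω) {ρ t : ℝ}
    (hρ : 0 < ρ) (hU : ∀ w ∈ Ω \ U, ρ ≤ kobayashiDist Ω (f 0) w) (ht0 : 0 ≤ t)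
    (ht : t < Real.tanh ρ) :
    kobayashiDist (Ω ∩ U) (f 0) (f (Real.tanh t)) ≤
      (t / Real.tanh ρ) / (1 - t / Real.tanh ρ) := by
  set r := Real.tanh ρ with hr
  have hr0 : 0 < r := Real.tanh_pos hρ
  have hr1 : r < 1 := Real.tanh_lt_one ρ
  have hscale : MapsTo (fun ζ : ℂ => (r : ℂ) * ζ) (Metric.ball 0 1) (Metric.ball 0 1) :=
    fun ζ hζ => by
      rw [mem_ball_zero_iff] at hζ ⊢
      rw [norm_mul, Complex.norm_real, Real.norm_of_nonneg hr0.le]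
      nlinarith [norm_nonneg ζ]
  have hmap : MapsTo (fun ζ : ℂ => f ((r : ℂ) * ζ)) (Metric.ball 0 1) (Ω ∩ U) := by
    intro ζ hζ
    -- A point outside `U` would be at distance at least `ρ` from the centre, while the Poincaré
    -- distance from `0` to `r ζ` is less than `artanh (tanh ρ) = ρ`.
    refine ⟨hfΩ (hscale hζ), by_contra fun h => ?_⟩
    have h1 := hU _ ⟨hfΩ (hscale hζ), h⟩
    have h2 := (DiscChain.of_disc hf hfΩ (Metric.mem_ball_self one_pos)
      (hscale hζ)).kobayashiDist_le
    have h3 := hscale hζ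
    rw [mem_ball_zero_iff] at hζ h3
    have h4 : ‖(r : ℂ) * ζ‖ < r := by
      rw [norm_mul, Complex.norm_real, Real.norm_of_nonneg hr0.le]
      nlinarith [norm_nonneg ζ]
    rw [poincareDist_zero_left] at h2
    have h5 := Real.artanh_lt_artanh (by linarith [norm_nonneg ((r : ℂ) * ζ)]) hr1 h4
    rw [hr, Real.artanh_tanh, ← hr] at h5
    linarith
  have htr : Real.tanh t / r ≤ t / r := by gcongr; exact Real.tanh_le_self ht0
  have htr1 : t / r < 1 := (div_lt_one hr0).2 ht
  have htr0 : 0 ≤ Real.tanh t / r := div_nonneg (Real.tanh_nonneg ht0) hr0.le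
  have hb : ((Real.tanh t / r : ℝ) : ℂ) ∈ Metric.ball (0 : ℂ) 1 := by
    rw [mem_ball_zero_iff, Complex.norm_real, Real.norm_of_nonneg htr0]
    linarith
  have hd : DifferentiableOn ℂ (fun ζ : ℂ => f ((r : ℂ) * ζ)) (Metric.ball 0 1) :=
    hf.comp (by fun_prop) hscale
  have h := (DiscChain.of_disc hd hmap (Metric.mem_ball_self one_pos) hb).kobayashiDist_le
  have hrC : (r : ℂ) ≠ 0 := by exact_mod_cast hr0.ne'
  rw [poincareDist_zero_left, Complex.norm_real, Real.norm_of_nonneg htr0, mul_zero,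
    Complex.ofReal_div, mul_div_cancel₀ _ hrC] at h
  refine h.trans ((Real.artanh_le_div_one_sub htr0 (by linarith)).trans ?_)
  gcongr

/-- Cut the radius into `N` equal arcs, recentre the disc at each division point and add the
one-step bounds `x / (1 - x)`, where `x = l / (N tanh ρ)`. The correction in the denominator
disappears as `N → ∞`. -/
theorem kobayashiDist_inter_le_of_disc_of_forall (hUo : IsOpen U) (ho : IsOpen Ω)
    (hc : IsConnected (Ω ∩ U)) {f : ℂ → EuclideanSpace ℂ (Fin d)}
    (hf : DifferentiableOn ℂ f (Metric.ball 0 1)) (hfΩ : MapsTo f (Metric.ball 0 1) Ω) {ρ l : ℝ}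
    (hρ : 0 < ρ) (hl : 0 ≤ l)
    (hU : ∀ t ∈ Icc 0 l, ∀ w ∈ Ω \ U, ρ ≤ kobayashiDist Ω (f (Real.tanh t)) w) :
    kobayashiDist (Ω ∩ U) (f 0) (f (Real.tanh l)) ≤ l / Real.tanh ρ := by
  have hk := isDistOn_kobayashiDist (ho.inter hUo) hc
  have hr0 : 0 < Real.tanh ρ := Real.tanh_pos hρ
  have hmem : ∀ t ∈ Icc 0 l, f (Real.tanh t) ∈ Ω ∩ U := by
    intro t ht
    refine ⟨hfΩ (tanh_mem_ball t), by_contra fun h => ?_⟩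
    have h1 := hU t ht _ ⟨hfΩ (tanh_mem_ball t), h⟩
    have h2 := (DiscChain.nil _ (hfΩ (tanh_mem_ball t))).kobayashiDist_le
    linarith
  have hstep : ∀ s t, 0 ≤ s → s ≤ t → t ≤ l → t - s < Real.tanh ρ →
      kobayashiDist (Ω ∩ U) (f (Real.tanh s)) (f (Real.tanh t)) ≤
        ((t - s) / Real.tanh ρ) / (1 - (t - s) / Real.tanh ρ) := by
    intro s t hs hst htl hlt
    obtain ⟨g, hg, hgΩ, h0, h1⟩ := exists_disc_reparam hf hfΩ (tanh_mem_ball s) (tanh_mem_ball t)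
    rw [poincareDist_tanh, abs_sub_comm, abs_of_nonneg (by linarith)] at h1
    rw [← h0, ← h1]
    refine kobayashiDist_inter_le_of_disc hg hgΩ hρ ?_ (by linarith) hlt
    rw [h0]
    exact hU s ⟨hs, by linarith⟩
  have hN : ∀ᶠ N : ℕ in atTop, kobayashiDist (Ω ∩ U) (f 0) (f (Real.tanh l)) ≤
      (l / Real.tanh ρ) / (1 - (l / Real.tanh ρ) / N) := by
    filter_upwards [eventually_gt_atTop 0,
      tendsto_natCast_atTop_atTop.eventually_gt_atTop (l / Real.tanh ρ)] with N hN0 hN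
    have hN0' : (0 : ℝ) < N := by exact_mod_cast hN0
    have hlN : l / N < Real.tanh ρ := by
      rw [div_lt_iff₀ hr0] at hN
      rw [div_lt_iff₀ hN0']
      linarith
    have hstep' : ∀ k : ℕ, k ≤ N → kobayashiDist (Ω ∩ U) (f 0) (f (Real.tanh (k * (l / N)))) ≤
        k * (((l / N) / Real.tanh ρ) / (1 - (l / N) / Real.tanh ρ)) := by
      have hle : ∀ k : ℕ, k ≤ N → (k : ℝ) * (l / N) ∈ Icc 0 l := by
        intro k hk
        refine ⟨by positivity, ?_⟩
        have : (k : ℝ) ≤ N := by exact_mod_cast hk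
        calc (k : ℝ) * (l / N) ≤ N * (l / N) := by gcongr
          _ = l := by field_simp
      intro k
      induction k with
      | zero =>
        intro _
        have := hk.self _ (hmem 0 ⟨le_rfl, hl⟩)
        simpa using this.le
      | succ k ih =>
        intro hkN
        have h1 := hstep (k * (l / N)) ((k + 1 : ℕ) * (l / N)) (hle k (by omega)).1
          (by push_cast; nlinarith [div_nonneg hl hN0'.le]) (hle _ hkN).2
          (by push_cast; linarith)
        have h2 := hk.triangle _ (hmem 0 ⟨le_rfl, hl⟩) _ (hmem _ (hle k (by omega))) _
          (hmem _ (hle _ hkN))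
        have e : ((k + 1 : ℕ) : ℝ) * (l / N) - k * (l / N) = l / N := by push_cast; ring
        rw [e] at h1
        have h3 := ih (by omega)
        simp only [Real.tanh_zero, Complex.ofReal_zero] at h2
        have e2 : ∀ x : ℝ, ((k + 1 : ℕ) : ℝ) * x = k * x + x := fun x => by push_cast; ring
        rw [e2 (l / N / Real.tanh ρ / _)]
        linarith
    have := hstep' N le_rfl
    rw [mul_div_cancel₀ _ hN0'.ne'] at this
    refine this.trans (le_of_eq ?_)
    have e : l / N / Real.tanh ρ = l / Real.tanh ρ / N := by ring
    rw [e, ← mul_div_assoc, mul_div_cancel₀ _ hN0'.ne']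
  have hlim : Tendsto (fun N : ℕ => (l / Real.tanh ρ) / (1 - (l / Real.tanh ρ) / (N : ℝ))) atTop
      (𝓝 ((l / Real.tanh ρ) / (1 - 0))) := by
    refine tendsto_const_nhds.div (tendsto_const_nhds.sub ?_) (by norm_num)
    exact tendsto_const_nhds.div_atTop tendsto_natCast_atTop_atTop
  rw [sub_zero, div_one] at hlim
  exact ge_of_tendsto hlim hN

/-- All discs of the chain run, between their marked points, inside the Kobayashi ball of radius `L`
about `z`, so the estimate for one disc applies to each. In the induction the ball of radius `L`
about the next point lies in the ball of radius `l + L` about the previous one. -/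
theorem kobayashiDist_inter_le_of_discChain (hUo : IsOpen U) (ho : IsOpen Ω)
    (hΩ : IsConnected Ω) (hc : IsConnected (Ω ∩ U)) {z w : EuclideanSpace ℂ (Fin d)} {ρ L : ℝ}
    (hρ : 0 < ρ) (h : DiscChain Ω z w L)
    (hU : ∀ z' ∈ Ω, kobayashiDist Ω z z' ≤ L → ∀ w' ∈ Ω \ U, ρ ≤ kobayashiDist Ω z' w') :
    kobayashiDist (Ω ∩ U) z w ≤ L / Real.tanh ρ := by
  have hk := isDistOn_kobayashiDist (ho.inter hUo) hc
  have hK := isDistOn_kobayashiDist ho hΩ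
  have hmem : ∀ z ∈ Ω, (∀ w' ∈ Ω \ U, ρ ≤ kobayashiDist Ω z w') → z ∈ Ω ∩ U := by
    refine fun z hz h => ⟨hz, by_contra fun hzU => ?_⟩
    have h1 := h z ⟨hz, hzU⟩
    rw [hK.self z hz] at h1
    linarith
  revert hU
  refine h.normalized_induction (P := fun z w L =>
    (∀ z' ∈ Ω, kobayashiDist Ω z z' ≤ L → ∀ w' ∈ Ω \ U, ρ ≤ kobayashiDist Ω z' w') →
      kobayashiDist (Ω ∩ U) z w ≤ L / Real.tanh ρ) ?_ ?_
  · intro z hz hU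
    rw [hk.self z (hmem z hz (hU z hz (hK.self z hz).le)), zero_div]
  · intro f l w L hl hf hfΩ hch ih hU
    have hL := hch.length_nonneg
    have h0 : ∀ t, 0 ≤ t → kobayashiDist Ω (f 0) (f (Real.tanh t)) ≤ t := fun t ht => by
      have := (DiscChain.of_disc_tanh hf hfΩ 0 t).kobayashiDist_le
      simpa [abs_of_nonneg ht] using this
    have hf0 : f 0 ∈ Ω := hfΩ (Metric.mem_ball_self one_pos)
    have hfl : f (Real.tanh l) ∈ Ω := hfΩ (tanh_mem_ball l)
    have h1 := kobayashiDist_inter_le_of_disc_of_forall hUo ho hc hf hfΩ hρ hl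
      fun t ht => hU _ (hfΩ (tanh_mem_ball t)) ((h0 t ht.1).trans (by linarith [ht.2]))
    have hU' : ∀ z' ∈ Ω, kobayashiDist Ω (f (Real.tanh l)) z' ≤ L →
        ∀ w' ∈ Ω \ U, ρ ≤ kobayashiDist Ω z' w' := fun z' hz' hzL => hU z' hz' (by
      linarith [hK.triangle _ hf0 _ hfl _ hz', h0 l hl])
    have h2 := ih hU'
    have hw : w ∈ Ω ∩ U := hmem w hch.right_mem (hU' w hch.right_mem hch.kobayashiDist_le)
    have h3 := hk.triangle (f 0) (hmem _ hf0 (hU _ hf0 (by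
      rw [hK.self _ hf0]; positivity))) (f (Real.tanh l)) (hmem _ hfl (hU _ hfl (by
      linarith [h0 l hl]))) w hw
    rw [add_div]
    linarith

/-- Localization: near a point that is far from the complement of `U`, the Kobayashi distance of
`Ω ∩ U` is close to that of `Ω`. -/
theorem kobayashiDist_inter_le (hUo : IsOpen U) (ho : IsOpen Ω)
    (hΩ : IsConnected Ω) (hc : IsConnected (Ω ∩ U)) {z w : EuclideanSpace ℂ (Fin d)}
    (hz : z ∈ Ω) (hw : w ∈ Ω) {R : ℝ} (hR : kobayashiDist Ω z w < R)
    (hU : ∀ w' ∈ Ω \ U, R ≤ kobayashiDist Ω z w') :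
    kobayashiDist (Ω ∩ U) z w ≤
      kobayashiDist Ω z w / Real.tanh (R - kobayashiDist Ω z w) := by
  have hK := isDistOn_kobayashiDist ho hΩ
  set h := kobayashiDist Ω z w with hh
  -- A chain of length below `h'` stays at distance at least `R - h'` from `Ω \ U`; afterwards `h'`
  -- decreases to `h`.
  have key : ∀ h' ∈ Ioo h R, kobayashiDist (Ω ∩ U) z w ≤ h' / Real.tanh (R - h') := by
    rintro h' ⟨h1, h2⟩
    obtain ⟨L, hL, hch⟩ := exists_discChain_lt ho hΩ hz hw h1
    refine (kobayashiDist_inter_le_of_discChain hUo ho hΩ hc (ρ := R - h') (by linarith) hch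
      fun z' hz' hzz' w' hw' => ?_).trans ?_
    · linarith [hU w' hw', hK.triangle z hz z' hz' w' hw'.1]
    · have := Real.tanh_pos (t := R - h') (by linarith)
      gcongr
  have hcont : ContinuousAt (fun h' => h' / Real.tanh (R - h')) h := by
    refine ContinuousAt.div continuousAt_id ?_ (Real.tanh_pos (by linarith)).ne'
    have : Continuous Real.tanh := by
      have : Real.tanh = fun x => Real.sinh x / Real.cosh x :=
        funext fun x => Real.tanh_eq_sinh_div_cosh x
      rw [this]
      exact Real.continuous_sinh.div Real.continuous_cosh fun x => (Real.cosh_pos x).ne'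
    exact this.continuousAt.comp (by fun_prop)
  refine ge_of_tendsto (hcont.tendsto.mono_left (nhdsWithin_le_nhds (s := Ioi h))) ?_
  filter_upwards [Ioo_mem_nhdsGT hR] with h' hh' using key h' hh'

end

noncomputable section

/-! ### Geodesic paths -/

/-- `γ`, restricted to `[0, L]`, is a geodesic of `(S, dist)` from `x` to `y`. -/
structure IsGeodesicPath {X : Type*} (S : Set X) (dist : X → X → ℝ) (x y : X) (L : ℝ)
    (γ : ℝ → X) : Prop where
  nonneg : 0 ≤ L
  source : γ 0 = x
  target : γ L = y
  mem : ∀ t ∈ Icc 0 L, γ t ∈ S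
  dist_eq : ∀ s ∈ Icc 0 L, ∀ t ∈ Icc 0 L, dist (γ s) (γ t) = |s - t|

namespace IsGeodesicPath

variable {X : Type*} {S : Set X} {dist : X → X → ℝ} {x y : X} {L : ℝ} {γ : ℝ → X}

theorem isGeodesicSegment (h : IsGeodesicPath S dist x y L γ) :
    IsGeodesicSegment S dist x y (γ '' Icc 0 L) :=
  ⟨L, γ, h.nonneg, h.source, h.target, h.mem, h.dist_eq, rfl⟩

theorem dist_of_le (h : IsGeodesicPath S dist x y L γ) {s t : ℝ} (hs : 0 ≤ s) (hst : s ≤ t)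
    (ht : t ≤ L) : dist (γ s) (γ t) = t - s := by
  rw [h.dist_eq s ⟨hs, hst.trans ht⟩ t ⟨hs.trans hst, ht⟩, abs_sub_comm,
    abs_of_nonneg (by linarith)]

theorem dist_left (h : IsGeodesicPath S dist x y L γ) {t : ℝ} (ht : t ∈ Icc 0 L) :
    dist x (γ t) = t := by
  rw [← h.source, h.dist_of_le le_rfl ht.1 ht.2, sub_zero]

theorem dist_right (h : IsGeodesicPath S dist x y L γ) {t : ℝ} (ht : t ∈ Icc 0 L) :
    dist (γ t) y = L - t := by
  rw [← h.target, h.dist_of_le ht.1 ht.2 le_rfl]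

theorem length_eq (h : IsGeodesicPath S dist x y L γ) : dist x y = L := by
  rw [← h.dist_left ⟨h.nonneg, le_rfl⟩, h.target]

theorem source_mem (h : IsGeodesicPath S dist x y L γ) : x ∈ S :=
  h.source ▸ h.mem 0 ⟨le_rfl, h.nonneg⟩

theorem target_mem (h : IsGeodesicPath S dist x y L γ) : y ∈ S :=
  h.target ▸ h.mem L ⟨h.nonneg, le_rfl⟩

theorem sub (h : IsGeodesicPath S dist x y L γ) {a b : ℝ} (ha : 0 ≤ a) (hab : a ≤ b)
    (hb : b ≤ L) : IsGeodesicPath S dist (γ a) (γ b) (b - a) fun t => γ (a + t) where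
  nonneg := by linarith
  source := by simp
  target := by simp
  mem t ht := h.mem _ ⟨by linarith [ht.1], by linarith [ht.2]⟩
  dist_eq s hs t ht := by
    rw [h.dist_eq _ ⟨by linarith [hs.1], by linarith [hs.2]⟩ _
      ⟨by linarith [ht.1], by linarith [ht.2]⟩, add_sub_add_left_eq_sub]

theorem reverse (h : IsGeodesicPath S dist x y L γ) :
    IsGeodesicPath S dist y x L fun t => γ (L - t) where
  nonneg := h.nonneg
  source := by simp [h.target]
  target := by simp [h.source]
  mem t ht := h.mem _ ⟨by linarith [ht.2], by linarith [ht.1]⟩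
  dist_eq s hs t ht := by
    rw [h.dist_eq _ ⟨by linarith [hs.2], by linarith [hs.1]⟩ _
      ⟨by linarith [ht.2], by linarith [ht.1]⟩, sub_sub_sub_cancel_left, abs_sub_comm]

end IsGeodesicPath

theorem IsGeodesicSegment.exists_path {X : Type*} {S : Set X} {dist : X → X → ℝ} {x y : X}
    {G : Set X} (h : IsGeodesicSegment S dist x y G) :
    ∃ L γ, IsGeodesicPath S dist x y L γ ∧ G = γ '' Icc 0 L := by
  obtain ⟨L, γ, h0, h1, h2, h3, h4, h5⟩ := h
  exact ⟨L, γ, ⟨h0, h1, h2, h3, h4⟩, h5⟩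

/-! ### The Hopf–Rinow theorem for length spaces -/

/-- Any two points are joined by `1`-Lipschitz curves defined on intervals whose lengths are
arbitrarily close to their distance. -/
def IsLengthMetric (X : Type*) [MetricSpace X] : Prop :=
  ∀ (x y : X) (R : ℝ), dist x y < R → ∃ (l : ℝ) (γ : ℝ → X), 0 ≤ l ∧ l < R ∧ γ 0 = x ∧ γ l = y ∧
    ∀ s t, 0 ≤ s → s ≤ t → t ≤ l → dist (γ s) (γ t) ≤ t - s

namespace IsLengthMetric

variable {X : Type*} [MetricSpace X]

theorem exists_between (hX : IsLengthMetric X) {x y : X} {s δ : ℝ} (hs : 0 ≤ s) (hδ : 0 < δ)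
    (h : dist x y < s + δ) : ∃ m, dist x m ≤ s ∧ dist m y < δ := by
  obtain ⟨l, γ, hl, hlR, h0, h1, h2⟩ := hX x y _ h
  refine ⟨γ (min l s), ?_, ?_⟩
  · have := h2 0 (min l s) le_rfl (le_min hl hs) (min_le_left _ _)
    rw [h0] at this
    exact this.trans (by simp)
  · have := h2 (min l s) l (le_min hl hs) (min_le_left _ _) le_rfl
    rw [h1] at this
    refine this.trans_lt ?_
    rcases min_cases l s with ⟨h, _⟩ | ⟨h, _⟩ <;> rw [h] <;> linarith

/-- Let `s` be the supremum of the radii with compact closed ball. Balls of radius slightly below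
`s` are nearly dense in the ball of radius `s`, so completeness makes that ball compact; local
compactness then enlarges the radius beyond `s`. -/
theorem properSpace (hX : IsLengthMetric X) [CompleteSpace X] [LocallyCompactSpace X] :
    ProperSpace X := by
  refine ⟨fun x R₀ => by_contra fun hR₀ => ?_⟩
  set S := {R : ℝ | IsCompact (Metric.closedBall x R)} with hS
  have hdown : ∀ R ∈ S, ∀ R' ≤ R, R' ∈ S := fun R hR R' h =>
    hR.of_isClosed_subset Metric.isClosed_closedBall (Metric.closedBall_subset_closedBall h)
  have hbdd : BddAbove S := ⟨R₀, fun R hR => le_of_not_gt fun h => hR₀ (hdown R hR R₀ h.le)⟩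
  have h0 : (0 : ℝ) ∈ S := by simp [hS]
  set s := sSup S with hs
  have hs0 : 0 ≤ s := le_csSup hbdd h0
  have hsS : s ∈ S := by
    refine isCompact_iff_totallyBounded_isComplete.2
      ⟨Metric.totallyBounded_iff.2 fun ε hε => ?_, Metric.isClosed_closedBall.isComplete⟩
    obtain ⟨R, hRS, hR0, hR⟩ : ∃ R ∈ S, 0 ≤ R ∧ s - ε / 2 < R := by
      obtain ⟨R, hR, h⟩ := exists_lt_of_lt_csSup ⟨0, h0⟩ (show s - ε / 2 < sSup S by linarith)
      rcases le_total 0 R with h' | h'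
      · exact ⟨R, hR, h', h⟩
      · exact ⟨0, h0, le_rfl, h.trans_le h'⟩
    obtain ⟨t, ht, hcov⟩ := Metric.totallyBounded_iff.1
      (isCompact_iff_totallyBounded_isComplete.1 hRS).1 (ε / 2) (half_pos hε)
    refine ⟨t, ht, fun y hy => ?_⟩
    rw [Metric.mem_closedBall, dist_comm] at hy
    obtain ⟨m, hm, hmy⟩ := hX.exists_between hR0 (half_pos hε) (show dist x y < R + ε / 2 by
      linarith)
    have := hcov (show m ∈ Metric.closedBall x R by rwa [Metric.mem_closedBall, dist_comm])
    simp only [mem_iUnion, Metric.mem_ball] at this ⊢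
    obtain ⟨i, hi, him⟩ := this
    exact ⟨i, hi, by linarith [dist_triangle y m i, dist_comm y m]⟩
  obtain ⟨K, hK, hKs⟩ := exists_compact_superset hsS
  obtain ⟨δ, hδ, hδK⟩ := hsS.exists_thickening_subset_open isOpen_interior hKs
  have : s + δ / 2 ∈ S := by
    refine hK.of_isClosed_subset Metric.isClosed_closedBall fun y hy => ?_
    rw [Metric.mem_closedBall, dist_comm] at hy
    obtain ⟨m, hm, hmy⟩ := hX.exists_between hs0 hδ (show dist x y < s + δ by linarith)
    refine interior_subset (hδK (Metric.mem_thickening_iff.2 ⟨m, ?_, by rwa [dist_comm]⟩))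
    rwa [Metric.mem_closedBall, dist_comm]
  linarith [le_csSup hbdd this]

/-- Almost shortest curves take values at time `t ≤ L` in a compact ball, so they converge pointwise
along a nonprincipal ultrafilter. The limit is `1`-Lipschitz on an interval of length `dist x y`,
which leaves no room for strict inequality. -/
theorem exists_geodesic (hX : IsLengthMetric X) [ProperSpace X] (x y : X) :
    ∃ γ : ℝ → X, IsGeodesicPath univ dist x y (dist x y) γ := by
  set L := dist x y with hL
  have hpath : ∀ n : ℕ, ∃ (l : ℝ) (γ : ℝ → X), 0 ≤ l ∧ l < L + 1 / ((n : ℝ) + 1) ∧ γ 0 = x ∧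
      γ l = y ∧ ∀ s t, 0 ≤ s → s ≤ t → t ≤ l → dist (γ s) (γ t) ≤ t - s :=
    fun n => hX x y _ (lt_add_of_pos_right _ (by positivity))
  choose l γ hl hlL h0 h1 h2 using hpath
  have hLl : ∀ n, L ≤ l n := fun n => by
    have := h2 n 0 (l n) le_rfl (hl n) le_rfl
    rwa [h0, h1, sub_zero] at this
  have hle : (hyperfilter ℕ : Filter ℕ) ≤ atTop := by
    rw [← Nat.cofinite_eq_atTop]; exact hyperfilter_le_cofinite
  have hlim : ∀ t ∈ Icc 0 L, ∃ c, Tendsto (fun n => γ n t) (hyperfilter ℕ : Filter ℕ) (𝓝 c) := by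
    intro t ht
    have hmem : ∀ n, γ n t ∈ Metric.closedBall x L := fun n => by
      have := h2 n 0 t le_rfl ht.1 (ht.2.trans (hLl n))
      rw [h0, sub_zero] at this
      rw [Metric.mem_closedBall, dist_comm]
      exact this.trans ht.2
    obtain ⟨c, -, hc⟩ := (isCompact_closedBall x L).ultrafilter_le_nhds
      ((hyperfilter ℕ).map fun n => γ n t) (by
        rw [Ultrafilter.coe_map, le_principal_iff]
        exact mem_map.2 (univ_mem' hmem))
    exact ⟨c, hc⟩
  have : Nonempty X := ⟨x⟩
  choose! g hg using hlim
  have hg0 : g 0 = x := tendsto_nhds_unique (hg 0 ⟨le_rfl, dist_nonneg⟩) (by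
    simp only [h0]; exact tendsto_const_nhds)
  have hg1 : g L = y := by
    refine tendsto_nhds_unique (hg L ⟨dist_nonneg, le_rfl⟩) ?_
    rw [tendsto_iff_dist_tendsto_zero]
    refine squeeze_zero (fun n => dist_nonneg) (fun n => ?_)
      (tendsto_one_div_add_atTop_nhds_zero_nat.mono_left hle)
    have := h2 n L (l n) dist_nonneg (hLl n) le_rfl
    rw [h1] at this
    linarith [hlL n]
  have hlip : ∀ s t, 0 ≤ s → s ≤ t → t ≤ L → dist (g s) (g t) ≤ t - s := fun s t hs hst ht =>
    le_of_tendsto ((hg s ⟨hs, hst.trans ht⟩).dist (hg t ⟨hs.trans hst, ht⟩))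
      (Eventually.of_forall fun n => h2 n s t hs hst (ht.trans (hLl n)))
  have heq : ∀ s t, 0 ≤ s → s ≤ t → t ≤ L → dist (g s) (g t) = t - s := fun s t hs hst ht => by
    refine le_antisymm (hlip s t hs hst ht) ?_
    have e1 := hlip 0 s le_rfl hs (hst.trans ht)
    have e2 := hlip t L (hs.trans hst) ht le_rfl
    rw [hg0] at e1
    rw [hg1] at e2
    linarith [dist_triangle4 x (g s) (g t) y]
  refine ⟨g, dist_nonneg, hg0, hg1, fun _ _ => mem_univ _, fun s hs t ht => ?_⟩
  rcases le_total s t with h | h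
  · rw [heq s t hs.1 h ht.2, abs_sub_comm, abs_of_nonneg (by linarith)]
  · rw [dist_comm, heq t s ht.1 h hs.2, abs_of_nonneg (by linarith)]

end IsLengthMetric

/-! ### Bounded domains as metric spaces -/

/-- A bounded domain of `ℂ^d`. -/
structure IsBoundedDomain {d : ℕ} (Ω : Set (EuclideanSpace ℂ (Fin d))) : Prop where
  isOpen : IsOpen Ω
  isConnected : IsConnected Ω
  isBounded : Bornology.IsBounded Ω

variable {d : ℕ} {Ω : Set (EuclideanSpace ℂ (Fin d))}

theorem IsBoundedDomain.isDistOn (h : IsBoundedDomain Ω) : IsDistOn Ω (kobayashiDist Ω) :=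
  isDistOn_kobayashiDist h.isOpen h.isConnected

theorem IsBoundedDomain.eq_of_kobayashiDist_eq_zero (h : IsBoundedDomain Ω)
    {x y : EuclideanSpace ℂ (Fin d)} (hx : x ∈ Ω) (hy : y ∈ Ω) (hxy : kobayashiDist Ω x y = 0) :
    x = y := by
  obtain ⟨c, hc, hcK⟩ := exists_mul_dist_le_kobayashiDist h.isOpen h.isConnected h.isBounded
  have := hcK x hx y hy
  rw [hxy] at this
  exact dist_le_zero.1 (nonpos_of_mul_nonpos_right this hc)

/-- A bounded domain, as a type that carries the Kobayashi distance. -/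
@[ext]
structure KobayashiSpace (h : IsBoundedDomain Ω) where
  /-- The underlying point of `ℂ^d`. -/
  val : EuclideanSpace ℂ (Fin d)
  property : val ∈ Ω

instance (h : IsBoundedDomain Ω) : MetricSpace (KobayashiSpace h) where
  dist x y := kobayashiDist Ω x.val y.val
  dist_self x := h.isDistOn.self _ x.property
  dist_comm x y := h.isDistOn.symm _ x.property _ y.property
  dist_triangle x y z := h.isDistOn.triangle _ x.property _ y.property _ z.property
  eq_of_dist_eq_zero {x y} hxy := KobayashiSpace.ext (h.eq_of_kobayashiDist_eq_zero x.property y.property hxy)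

namespace KobayashiSpace

variable (h : IsBoundedDomain Ω)

/-- The inclusion of a bounded domain into `ℂ^d`. -/
def incl (x : KobayashiSpace h) : EuclideanSpace ℂ (Fin d) := x.val

theorem isLengthMetric : IsLengthMetric (KobayashiSpace h) := by
  intro x y R hR
  obtain ⟨L, hLR, hL⟩ := exists_discChain_lt h.isOpen h.isConnected x.property y.property hR
  obtain ⟨γ, h0, h1, h2⟩ := hL.exists_curve
  have hmem : ∀ t ∈ Icc 0 L, γ t ∈ Ω := fun t ht => (h2 t t ht.1 le_rfl ht.2).left_mem
  have hL0 := hL.length_nonneg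
  have hlift : ∀ t ∈ Icc 0 L, ∃ p : KobayashiSpace h, p.val = γ t := fun t ht =>
    ⟨⟨γ t, hmem t ht⟩, rfl⟩
  have : Nonempty (KobayashiSpace h) := ⟨x⟩
  choose! Γ hΓ using hlift
  refine ⟨L, Γ, hL0, hLR, KobayashiSpace.ext ?_, KobayashiSpace.ext ?_, ?_⟩
  · rw [hΓ 0 ⟨le_rfl, hL0⟩, h0]
  · rw [hΓ L ⟨hL0, le_rfl⟩, h1]
  · intro s t hs hst ht
    change kobayashiDist Ω _ _ ≤ t - s
    rw [hΓ s ⟨hs, hst.trans ht⟩, hΓ t ⟨hs.trans hst, ht⟩]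
    exact (h2 s t hs hst ht).kobayashiDist_le

theorem continuous_incl : Continuous (incl h) := by
  obtain ⟨c, hc, hcK⟩ := exists_mul_dist_le_kobayashiDist h.isOpen h.isConnected h.isBounded
  refine (LipschitzWith.of_dist_le_mul (K := c⁻¹.toNNReal) fun x y => ?_).continuous
  rw [Real.coe_toNNReal _ (inv_pos.2 hc).le, le_inv_mul_iff₀ hc]
  exact hcK _ x.property _ y.property

/-- The two-sided comparison with the Euclidean distance shows that both distances induce the same
topology; hence the space is locally compact, as Hopf–Rinow requires. -/
theorem isOpenEmbedding_incl : IsOpenEmbedding (incl h) := by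
  refine ⟨⟨isInducing_iff_nhds.2 fun x => le_antisymm
    ((continuous_incl h).tendsto x).le_comap ?_, fun x y hxy => KobayashiSpace.ext hxy⟩, ?_⟩
  · have : Tendsto (fun y : KobayashiSpace h => dist y x) (comap (incl h) (𝓝 (incl h x)))
        (𝓝 0) := by
      simp only [dist_comm _ x]
      exact (tendsto_kobayashiDist_nhds h.isOpen x.property).comp tendsto_comap
    exact tendsto_iff_dist_tendsto_zero.2 this
  · have : range (incl h) = Ω := by
      ext z
      exact ⟨fun ⟨y, hy⟩ => hy ▸ y.property, fun hz => ⟨⟨z, hz⟩, rfl⟩⟩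
    rw [this]
    exact h.isOpen

instance : LocallyCompactSpace (KobayashiSpace h) :=
  (isOpenEmbedding_incl h).locallyCompactSpace

theorem completeSpace (hc : IsCompleteHyperbolic Ω) : CompleteSpace (KobayashiSpace h) := by
  refine Metric.complete_of_cauchySeq_tendsto fun u hu => ?_
  obtain ⟨x, hx, hux⟩ := hc.2 (fun n => (u n).val) (fun n => (u n).property) fun ε hε =>
    Metric.cauchySeq_iff.1 hu ε hε
  exact ⟨⟨x, hx⟩, tendsto_iff_dist_tendsto_zero.2 hux⟩

theorem properSpace (hc : IsCompleteHyperbolic Ω) : ProperSpace (KobayashiSpace h) :=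
  have := completeSpace h hc
  (isLengthMetric h).properSpace

end KobayashiSpace

theorem IsBoundedDomain.isCompact_closedBall (h : IsBoundedDomain Ω)
    (hc : IsCompleteHyperbolic Ω) {o : EuclideanSpace ℂ (Fin d)} (ho : o ∈ Ω) (R : ℝ) :
    IsCompact {z | z ∈ Ω ∧ kobayashiDist Ω z o ≤ R} := by
  have := KobayashiSpace.properSpace h hc
  have := (ProperSpace.isCompact_closedBall (⟨o, ho⟩ : KobayashiSpace h) R).image
    (KobayashiSpace.continuous_incl h)
  convert this using 1
  ext z
  constructor
  · rintro ⟨hz, hzR⟩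
    exact ⟨⟨z, hz⟩, hzR, rfl⟩
  · rintro ⟨y, hy, rfl⟩
    exact ⟨y.property, hy⟩

theorem IsBoundedDomain.exists_geodesic (h : IsBoundedDomain Ω)
    (hc : IsCompleteHyperbolic Ω) {x y : EuclideanSpace ℂ (Fin d)} (hx : x ∈ Ω) (hy : y ∈ Ω) :
    ∃ γ, IsGeodesicPath Ω (kobayashiDist Ω) x y (kobayashiDist Ω x y) γ := by
  have := KobayashiSpace.properSpace h hc
  obtain ⟨γ, hγ⟩ := (KobayashiSpace.isLengthMetric h).exists_geodesic ⟨x, hx⟩ ⟨y, hy⟩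
  exact ⟨fun t => (γ t).val, hγ.nonneg, congrArg KobayashiSpace.val hγ.source,
    congrArg KobayashiSpace.val hγ.target, fun t _ => (γ t).property, hγ.dist_eq⟩

end

noncomputable section

/-! ### The Gromov product and the four-point condition -/

section GromovProduct

variable {X : Type*} {S : Set X} {dist : X → X → ℝ} {o o' x y z : X}

theorem IsDistOn.gromovProd_comm (h : IsDistOn S dist) (hx : x ∈ S) (hy : y ∈ S) :
    gromovProd dist o x y = gromovProd dist o y x := by
  rw [gromovProd, gromovProd, h.symm x hx y hy]
  ring

theorem IsDistOn.gromovProd_nonneg (h : IsDistOn S dist) (ho : o ∈ S) (hx : x ∈ S)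
    (hy : y ∈ S) : 0 ≤ gromovProd dist o x y := by
  have := h.triangle x hx o ho y hy
  rw [h.symm o ho y hy] at this
  rw [gromovProd]
  linarith

theorem IsDistOn.gromovProd_le_left (h : IsDistOn S dist) (ho : o ∈ S) (hx : x ∈ S)
    (hy : y ∈ S) : gromovProd dist o x y ≤ dist x o := by
  have := h.triangle y hy x hx o ho
  rw [h.symm y hy x hx] at this
  rw [gromovProd]
  linarith

theorem IsDistOn.gromovProd_le_right (h : IsDistOn S dist) (ho : o ∈ S) (hx : x ∈ S)
    (hy : y ∈ S) : gromovProd dist o x y ≤ dist y o := by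
  rw [h.gromovProd_comm hx hy]
  exact h.gromovProd_le_left ho hy hx

theorem IsDistOn.gromovProd_le_add (h : IsDistOn S dist) (ho : o ∈ S) (ho' : o' ∈ S)
    (hx : x ∈ S) (hy : y ∈ S) :
    gromovProd dist o x y ≤ gromovProd dist o' x y + dist o o' := by
  have h1 := h.triangle x hx o' ho' o ho
  have h2 := h.triangle y hy o' ho' o ho
  rw [h.symm o' ho' o ho] at h1 h2
  rw [gromovProd, gromovProd]
  linarith

/-- Add the triangle inequalities from `x` and from `y` to `o` through `c`, and use `dist x c + dist
c y = dist x y`. -/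
theorem IsDistOn.gromovProd_le_of_mem_geodesic (h : IsDistOn S dist) (ho : o ∈ S) {G : Set X}
    (hG : IsGeodesicSegment S dist x y G) {c : X} (hc : c ∈ G) :
    c ∈ S ∧ gromovProd dist o x y ≤ dist c o := by
  obtain ⟨L, γ, hγ, rfl⟩ := hG.exists_path
  obtain ⟨t, ht, rfl⟩ := hc
  have hcS := hγ.mem t ht
  refine ⟨hcS, ?_⟩
  have h1 := h.triangle x hγ.source_mem _ hcS o ho
  have h2 := h.triangle y hγ.target_mem _ hcS o ho
  rw [hγ.dist_left ht] at h1
  rw [h.symm y hγ.target_mem _ hcS, hγ.dist_right ht] at h2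
  rw [gromovProd, hγ.length_eq]
  linarith

/-- In a geodesic space with thin triangles, the distance from a point to a geodesic is bounded
by the Gromov product, up to a constant. -/
theorem IsDistOn.exists_mem_geodesic_dist_le (h : IsDistOn S dist)
    (hgeo : ∀ x ∈ S, ∀ y ∈ S, ∃ G, IsGeodesicSegment S dist x y G) {δ : ℝ} (hδ : 0 < δ)
    (hthin : ∀ x ∈ S, ∀ y ∈ S, ∀ z ∈ S, ∀ G₁ G₂ G₃ : Set X,
      IsGeodesicSegment S dist x y G₁ → IsGeodesicSegment S dist y z G₂ →
      IsGeodesicSegment S dist z x G₃ → ∀ a ∈ G₁, ∃ b ∈ G₂ ∪ G₃, dist a b ≤ δ)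
    (ho : o ∈ S) {G : Set X} (hG : IsGeodesicSegment S dist x y G) :
    ∃ c ∈ G, dist c o ≤ gromovProd dist o x y + 3 * δ := by
  obtain ⟨L, γ, hγ, rfl⟩ := hG.exists_path
  have hx := hγ.source_mem
  have hy := hγ.target_mem
  obtain ⟨G₂, hG₂⟩ := hgeo y hy o ho
  obtain ⟨G₃, hG₃⟩ := hgeo o ho x hx
  have hL := hγ.nonneg
  set A := {t | t ∈ Icc 0 L ∧ ∃ b ∈ G₃, dist (γ t) b ≤ δ} with hA
  set B := {t | t ∈ Icc 0 L ∧ ∃ b ∈ G₂, dist (γ t) b ≤ δ} with hB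
  have hAB : ∀ t ∈ Icc 0 L, t ∈ A ∨ t ∈ B := fun t ht => by
    obtain ⟨b, hb | hb, hab⟩ := hthin x hx y hy o ho _ _ _ hG hG₂ hG₃ (γ t) ⟨t, ht, rfl⟩
    · exact Or.inr ⟨ht, b, hb, hab⟩
    · exact Or.inl ⟨ht, b, hb, hab⟩
  have h0A : (0 : ℝ) ∈ A := by
    obtain ⟨l, g, hg, rfl⟩ := hG₃.exists_path
    refine ⟨⟨le_rfl, hL⟩, x, ⟨l, ⟨hg.nonneg, le_rfl⟩, hg.target⟩, ?_⟩
    rw [hγ.source, h.self x hx]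
    exact hδ.le
  have hLB : L ∈ B := by
    obtain ⟨l, g, hg, rfl⟩ := hG₂.exists_path
    refine ⟨⟨hL, le_rfl⟩, y, ⟨0, ⟨le_rfl, hg.nonneg⟩, hg.source⟩, ?_⟩
    rw [hγ.target, h.self y hy]
    exact hδ.le
  have hbdd : BddAbove A := ⟨L, fun t ht => ht.1.2⟩
  -- `A` and `B` cover the interval, `0 ∈ A` and `L ∈ B`. Take `t` just below `sSup A`, and `t'`
  -- equal to `sSup A + δ / 2`, which is past `A` and so in `B`, or to `L` if that leaves the
  -- interval.
  obtain ⟨t, ht, t', ht', htt⟩ : ∃ t ∈ A, ∃ t' ∈ B, |t - t'| ≤ δ := by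
    obtain ⟨t, ht, hlt⟩ := exists_lt_of_lt_csSup ⟨0, h0A⟩ (sub_lt_self (sSup A) (half_pos hδ))
    have hle := le_csSup hbdd ht
    rcases le_or_gt (sSup A + δ / 2) L with hcase | hcase
    · refine ⟨t, ht, sSup A + δ / 2, ?_, abs_le.2 ⟨by linarith, by linarith⟩⟩
      refine (hAB _ ⟨by linarith [ht.1.1], hcase⟩).resolve_left fun hmem => ?_
      linarith [le_csSup hbdd hmem]
    · exact ⟨t, ht, L, hLB, abs_le.2 ⟨by linarith, by linarith [ht.1.2]⟩⟩
  obtain ⟨htI, a, ha, hta⟩ := ht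
  obtain ⟨htI', b, hb, htb⟩ := ht'
  refine ⟨γ t, ⟨t, htI, rfl⟩, ?_⟩
  have htt' := hγ.dist_eq t htI t' htI'
  have hc := hγ.mem t htI
  have hc' := hγ.mem t' htI'
  have haS := (h.gromovProd_le_of_mem_geodesic ho hG₃ ha).1
  have hbS := (h.gromovProd_le_of_mem_geodesic ho hG₂ hb).1
  have hxa : dist x o = dist x a + dist a o := by
    obtain ⟨l, g, hg, rfl⟩ := hG₃.exists_path
    obtain ⟨s, hs, rfl⟩ := ha
    rw [h.symm x hx o ho, hg.length_eq, h.symm x hx _ haS, hg.dist_right hs,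
      h.symm _ haS o ho, hg.dist_left hs]
    ring
  have hyb : dist y o = dist y b + dist b o := by
    obtain ⟨l, g, hg, rfl⟩ := hG₂.exists_path
    obtain ⟨s, hs, rfl⟩ := hb
    rw [hg.length_eq, hg.dist_left hs, hg.dist_right hs]
    ring
  -- The detours through `a` and through `b` cost `2δ` each, and moving from `γ t'` to `γ t` costs
  -- another `2δ`; the product halves the total `6δ`.
  have e1 := h.triangle x hx a haS _ hc
  have e2 := h.triangle _ hc a haS o ho
  have e3 := h.triangle y hy b hbS _ hc'
  have e4 := h.triangle _ hc' b hbS o ho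
  have e5 := h.triangle y hy _ hc' _ hc
  have e6 := h.triangle _ hc _ hc' o ho
  have e7 := h.triangle x hx _ hc y hy
  rw [h.symm a haS _ hc] at e1
  rw [h.symm b hbS _ hc'] at e3
  rw [h.symm _ hc' _ hc] at e5
  rw [h.symm _ hc y hy] at e7
  rw [gromovProd]
  linarith

/-- The four-point condition at the base point `o`. -/
def FourPointCondition (S : Set X) (dist : X → X → ℝ) (o : X) (δ : ℝ) : Prop :=
  ∀ x ∈ S, ∀ y ∈ S, ∀ z ∈ S,
    min (gromovProd dist o x y) (gromovProd dist o y z) ≤ gromovProd dist o x z + δ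

/-- A point `c` of `[x, z]` lies within `(x | z)_o + 3δ` of `o`; thinness moves it by `δ` onto
another side, whose product is at most the distance from `o` to that side. -/
theorem IsDistOn.exists_fourPointCondition (h : IsDistOn S dist)
    (hG : IsGromovHyperbolic S dist) : ∃ δ, ∀ o ∈ S, FourPointCondition S dist o δ := by
  obtain ⟨hgeo, δ, hδ, hthin⟩ := hG
  refine ⟨4 * δ, fun o ho x hx y hy z hz => ?_⟩
  obtain ⟨G₁, hG₁⟩ := hgeo x hx z hz
  obtain ⟨G₂, hG₂⟩ := hgeo z hz y hy
  obtain ⟨G₃, hG₃⟩ := hgeo y hy x hx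
  obtain ⟨c, hc, hco⟩ := h.exists_mem_geodesic_dist_le hgeo hδ hthin ho hG₁
  have hcS := (h.gromovProd_le_of_mem_geodesic ho hG₁ hc).1
  obtain ⟨b, hb, hcb⟩ := hthin x hx z hz y hy _ _ _ hG₁ hG₂ hG₃ c hc
  rcases hb with hb | hb
  · obtain ⟨hbS, hbo⟩ := h.gromovProd_le_of_mem_geodesic ho hG₂ hb
    have e := h.triangle b hbS c hcS o ho
    rw [h.symm b hbS c hcS] at e
    rw [h.gromovProd_comm hz hy] at hbo
    exact (min_le_right _ _).trans (by linarith)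
  · obtain ⟨hbS, hbo⟩ := h.gromovProd_le_of_mem_geodesic ho hG₃ hb
    have e := h.triangle b hbS c hcS o ho
    rw [h.symm b hbS c hcS] at e
    rw [h.gromovProd_comm hy hx] at hbo
    exact (min_le_left _ _).trans (by linarith)

/-- This is the form without base point. Four instances of the condition give the inequality for
sums of products with `2δ`; in distances the `o`-terms cancel and the constant doubles. -/
theorem FourPointCondition.sum_le (h : IsDistOn S dist) (ho : o ∈ S) {δ : ℝ}
    (hF : FourPointCondition S dist o δ) {t : X} (hx : x ∈ S) (hy : y ∈ S) (hz : z ∈ S)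
    (ht : t ∈ S) :
    dist x y + dist z t ≤ max (dist x z + dist y t) (dist x t + dist y z) + 4 * δ := by
  have key : min (gromovProd dist o x z + gromovProd dist o y t)
      (gromovProd dist o x t + gromovProd dist o y z) ≤
      gromovProd dist o x y + gromovProd dist o z t + 2 * δ := by
    have c1 := h.gromovProd_comm (o := o) hy hz
    have c2 := h.gromovProd_comm (o := o) hz hx
    have c3 := h.gromovProd_comm (o := o) ht hy
    have c4 := h.gromovProd_comm (o := o) ht hx
    have a1 := hF x hx z hz y hy
    have a2 := hF x hx t ht y hy
    have a3 := hF z hz x hx t ht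
    have a4 := hF z hz y hy t ht
    rw [c2] at a3
    rw [c3] at a2
    rw [← c1] at a1 a4
    rw [min_le_iff] at a1 a2 a3 a4 ⊢
    grind
  simp only [gromovProd] at key
  have s1 := h.symm x hx o ho
  rcases min_le_iff.1 key with k | k
  · have := le_max_left (dist x z + dist y t) (dist x t + dist y z)
    linarith
  · have := le_max_right (dist x z + dist y t) (dist x t + dist y z)
    linarith

/-- A geodesic space that satisfies the four-point condition at one base point is Gromov
hyperbolic. -/
theorem FourPointCondition.isGromovHyperbolic (h : IsDistOn S dist)
    (hgeo : ∀ x ∈ S, ∀ y ∈ S, ∃ G, IsGeodesicSegment S dist x y G) (ho : o ∈ S) {δ : ℝ}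
    (hδ : 0 < δ) (hF : FourPointCondition S dist o δ) : IsGromovHyperbolic S dist := by
  refine ⟨hgeo, 8 * δ, by linarith, ?_⟩
  have near : ∀ u ∈ S, ∀ a ∈ S, ∀ v ∈ S, ∀ G, IsGeodesicSegment S dist u v G →
      ∃ b ∈ G, dist a b ≤ gromovProd dist a u v + 4 * δ := by
    intro u hu a ha v hv G hG
    obtain ⟨L, γ, hγ, rfl⟩ := hG.exists_path
    have hL := hγ.length_eq
    have t1 := h.triangle u hu v hv a ha
    have t2 := h.triangle v hv u hu a ha
    have t3 := h.triangle u hu a ha v hv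
    rw [h.symm v hv u hu] at t2
    rw [h.symm a ha v hv] at t3
    -- At this parameter the two sums inside the maximum of the four-point inequality for `a, b, u,
    -- v` coincide.
    have hs : (dist u a + dist u v - dist v a) / 2 ∈ Icc 0 L := ⟨by linarith, by linarith⟩
    refine ⟨_, ⟨_, hs, rfl⟩, ?_⟩
    have hb := hγ.mem _ hs
    have d1 := hγ.dist_left hs
    have d2 := hγ.dist_right hs
    have := hF.sum_le h ho ha hb hu hv
    rw [h.symm _ hb u hu, d1, d2, h.symm a ha u hu, h.symm a ha v hv] at this
    rw [gromovProd]
    rcases max_cases (dist u a + (L - (dist u a + dist u v - dist v a) / 2))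
      (dist v a + (dist u a + dist u v - dist v a) / 2) with ⟨e, _⟩ | ⟨e, _⟩ <;>
    · rw [e] at this
      linarith
  intro x hx y hy z hz G₁ G₂ G₃ hG₁ hG₂ hG₃ a ha
  obtain ⟨L, γ, hγ, rfl⟩ := hG₁.exists_path
  obtain ⟨t, ht, rfl⟩ := ha
  have haS := hγ.mem t ht
  have e1 := hγ.dist_left ht
  have e2 := hγ.dist_right ht
  have hL := hγ.length_eq
  -- Whichever sum is larger, the Gromov product at the point of `G₁` of `z` with `x`, or of `y`
  -- with `z`, is at most `2δ`; `near` adds `4δ`.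
  have := hF.sum_le h ho hx hy haS hz
  rw [e1, hL, h.symm y hy _ haS, e2] at this
  rcases le_total (t + dist y z) (dist x z + (L - t)) with hle | hle
  · rw [max_eq_right hle] at this
    obtain ⟨b, hb, hab⟩ := near z hz _ haS x hx G₃ hG₃
    refine ⟨b, Or.inr hb, hab.trans ?_⟩
    rw [gromovProd, h.symm z hz _ haS, e1, h.symm z hz x hx]
    linarith
  · rw [max_eq_left hle] at this
    obtain ⟨b, hb, hab⟩ := near y hy _ haS z hz G₂ hG₂
    refine ⟨b, Or.inl hb, hab.trans ?_⟩
    rw [gromovProd, h.symm z hz _ haS, h.symm y hy _ haS, e2]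
    linarith

end GromovProduct
end

noncomputable section

variable {d : ℕ} {Ω D U V : Set (EuclideanSpace ℂ (Fin d))} {o p : EuclideanSpace ℂ (Fin d)}

/-! ### Visibility and the Gromov product -/

/-- The Gromov products of points of `D ∩ A` that stay apart from each other are bounded. -/
def HasBoundedProducts (D A : Set (EuclideanSpace ℂ (Fin d))) (o : EuclideanSpace ℂ (Fin d)) :
    Prop :=
  ∀ ε > 0, ∃ C, ∀ x ∈ D ∩ A, ∀ y ∈ D ∩ A, ε ≤ dist x y →
    gromovProd (kobayashiDist D) o x y ≤ C

/-- The Gromov products of points of `D` close to `p` and to `q` are bounded. -/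
def HasBoundedProductsAt (D : Set (EuclideanSpace ℂ (Fin d)))
    (o p q : EuclideanSpace ℂ (Fin d)) : Prop :=
  ∃ C, ∀ᶠ u : EuclideanSpace ℂ (Fin d) × EuclideanSpace ℂ (Fin d) in 𝓝 (p, q),
    u.1 ∈ D → u.2 ∈ D → gromovProd (kobayashiDist D) o u.1 u.2 ≤ C

theorem VisibilityCondition.hasBoundedProductsAt (hD : IsBoundedDomain D)
    (hc : IsCompleteHyperbolic D) (ho : o ∈ D) {q : EuclideanSpace ℂ (Fin d)}
    (h : VisibilityCondition D p q) : HasBoundedProductsAt D o p q := by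
  obtain ⟨Vp, hVp, Vq, hVq, K, hK, hKD, -, hvis⟩ := h
  obtain ⟨C, hC⟩ := (hK.image_of_continuousOn
    ((continuousOn_kobayashiDist hD.isOpen hD.isConnected ho).mono hKD)).bddAbove
  refine ⟨C, ?_⟩
  filter_upwards [prod_mem_nhds hVp hVq] with u hu h1 h2
  obtain ⟨γ, hγ⟩ := hD.exists_geodesic hc h1 h2
  obtain ⟨c, hcG, hcK⟩ := hvis u.1 ⟨hu.1, h1⟩ u.2 ⟨hu.2, h2⟩ _ hγ.isGeodesicSegment
  exact (hD.isDistOn.gromovProd_le_of_mem_geodesic ho hγ.isGeodesicSegment hcG).2.trans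
    (hC ⟨c, hcK, rfl⟩)

/-- The pairs of points of `A` at distance at least `ε` form a compact set, so local bounds suffice.
Near a pair with a member in `D` the product is at most a locally bounded distance to `o`, and
outside `closure D` there is nothing to bound. -/
theorem HasBoundedProducts.of_at (hD : IsBoundedDomain D) (ho : o ∈ D)
    {A : Set (EuclideanSpace ℂ (Fin d))} (hA : IsCompact A)
    (h : ∀ p ∈ frontier D ∩ A, ∀ q ∈ frontier D ∩ A, p ≠ q → HasBoundedProductsAt D o p q) :
    HasBoundedProducts D A o := by
  have hnhds : ∀ z ∈ D, ∀ᶠ w in 𝓝 z, kobayashiDist D w o ≤ kobayashiDist D z o + 1 := by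
    intro z hz
    have := (continuousOn_kobayashiDist hD.isOpen hD.isConnected ho).continuousAt
      (hD.isOpen.mem_nhds hz)
    exact (this.eventually (gt_mem_nhds (lt_add_one _))).mono fun w hw => hw.le
  have hfr : ∀ z, z ∈ frontier D ∨ z ∈ D ∨ z ∉ closure D := fun z => by
    rw [hD.isOpen.frontier_eq]
    by_cases h1 : z ∈ D <;> by_cases h2 : z ∈ closure D <;> simp [h1, h2]
  intro ε hε
  have hT : IsCompact ((A ×ˢ A) ∩ {u | ε ≤ dist u.1 u.2}) :=
    (hA.prod hA).inter_right (isClosed_le continuous_const continuous_dist)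
  have : ∃ C, ∀ u ∈ (A ×ˢ A) ∩ {u | ε ≤ dist u.1 u.2}, u.1 ∈ D → u.2 ∈ D →
      gromovProd (kobayashiDist D) o u.1 u.2 ≤ C := by
    refine hT.induction_on (p := fun T => ∃ C, ∀ u ∈ T, u.1 ∈ D → u.2 ∈ D →
      gromovProd (kobayashiDist D) o u.1 u.2 ≤ C) ⟨0, by simp⟩ ?_ ?_ ?_
    · rintro s t hst ⟨C, hC⟩
      exact ⟨C, fun u hu => hC u (hst hu)⟩
    · rintro s t ⟨C, hC⟩ ⟨C', hC'⟩
      refine ⟨max C C', fun u hu h1 h2 => ?_⟩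
      rcases hu with hu | hu
      · exact (hC u hu h1 h2).trans (le_max_left _ _)
      · exact (hC' u hu h1 h2).trans (le_max_right _ _)
    · rintro ⟨a, b⟩ ⟨⟨ha, hb⟩, hab⟩
      have hne : a ≠ b := fun h => by
        have : ε ≤ dist a b := hab
        rw [h, dist_self] at this
        linarith
      obtain ⟨C, hC⟩ : HasBoundedProductsAt D o a b := by
        rw [HasBoundedProductsAt, nhds_prod_eq]
        rcases hfr a with h1 | h1 | h1
        · rcases hfr b with h2 | h2 | h2
          · rw [← nhds_prod_eq]
            exact h a ⟨h1, ha⟩ b ⟨h2, hb⟩ hne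
          · refine ⟨kobayashiDist D b o + 1, ?_⟩
            filter_upwards [(hnhds b h2).prod_inr (𝓝 a)] with u hu hu1 hu2
            exact (hD.isDistOn.gromovProd_le_right ho hu1 hu2).trans hu
          · refine ⟨0, ?_⟩
            filter_upwards [(isClosed_closure.isOpen_compl.eventually_mem h2).prod_inr (𝓝 a)]
              with u hu hu1 hu2
            exact absurd (subset_closure hu2) hu
        · refine ⟨kobayashiDist D a o + 1, ?_⟩
          filter_upwards [(hnhds a h1).prod_inl (𝓝 b)] with u hu hu1 hu2
          exact (hD.isDistOn.gromovProd_le_left ho hu1 hu2).trans hu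
        · refine ⟨0, ?_⟩
          filter_upwards [(isClosed_closure.isOpen_compl.eventually_mem h1).prod_inl (𝓝 b)]
            with u hu hu1 hu2
          exact absurd (subset_closure hu1) hu
      exact ⟨_, mem_nhdsWithin_of_mem_nhds hC, C, fun u hu => hu⟩
  obtain ⟨C, hC⟩ := this
  exact ⟨C, fun x hx y hy hxy => hC (x, y) ⟨⟨hx.2, hy.2⟩, hxy⟩ hx.1 hy.1⟩

/-! ### Localization along geodesics -/

theorem Real.tanh_le_tanh {x y : ℝ} (h : x ≤ y) : Real.tanh x ≤ Real.tanh y := by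
  by_contra! hlt
  have := Real.artanh_lt_artanh (Real.neg_one_lt_tanh y) (Real.tanh_lt_one x) hlt
  rw [Real.artanh_tanh, Real.artanh_tanh] at this
  linarith

/-- Exactly, `coth x = 1 + 2 e^{-2x} / (1 - e^{-2x})`. The exponential decay of the excess over `1`
is what makes localization errors summable. -/
theorem Real.inv_tanh_le {x₀ x : ℝ} (h₀ : 0 < x₀) (h : x₀ ≤ x) :
    (Real.tanh x)⁻¹ ≤ 1 + 2 / (1 - Real.exp (-(2 * x₀))) * Real.exp (-(2 * x)) := by
  have he : Real.exp (-(2 * x)) ≤ Real.exp (-(2 * x₀)) := Real.exp_le_exp.2 (by linarith)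
  have h1 : Real.exp (-(2 * x₀)) < 1 := Real.exp_lt_one_iff.2 (by linarith)
  have hpos := Real.exp_pos (-(2 * x))
  have htanh : (Real.tanh x)⁻¹ = 1 + 2 / (1 - Real.exp (-(2 * x))) * Real.exp (-(2 * x)) := by
    have e : Real.exp (-(2 * x)) = Real.exp (-x) ^ 2 := by
      rw [sq, ← Real.exp_add]; ring_nf
    have e' : Real.exp x * Real.exp (-x) = 1 := by rw [← Real.exp_add]; simp
    have hne : 1 - Real.exp (-(2 * x)) ≠ 0 := by linarith
    have hp := Real.exp_pos x
    have hq := Real.exp_pos (-x)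
    have hne' : Real.exp x - Real.exp (-x) ≠ 0 := by
      have := Real.exp_lt_exp.2 (show -x < x by linarith)
      linarith
    rw [Real.tanh_eq, inv_div, e]
    rw [e] at hne
    field_simp
    linear_combination (-2 * Real.exp (-x)) * e'
  rw [htanh]
  have : 0 < 1 - Real.exp (-(2 * x₀)) := by linarith
  gcongr

/-- A discrete integration: short-step bounds telescope when written as increments of a potential
`ψ`. It is used with a linear `ψ`, and with one that has an exponentially decaying correction. -/
theorem IsDistOn.le_sub_of_steps {X : Type*} {S : Set X} {k : X → X → ℝ} (hk : IsDistOn S k)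
    {γ : ℝ → X} {L h₀ : ℝ} (hL : 0 ≤ L) (hh₀ : 0 < h₀) (hγ : ∀ t ∈ Icc 0 L, γ t ∈ S)
    (ψ : ℝ → ℝ) (hstep : ∀ s h, 0 ≤ s → 0 ≤ h → h ≤ h₀ → s + h ≤ L →
      k (γ s) (γ (s + h)) ≤ ψ (s + h) - ψ s) : k (γ 0) (γ L) ≤ ψ L - ψ 0 := by
  have key : ∀ n : ℕ, ∀ t ∈ Icc 0 L, t ≤ n * h₀ → k (γ 0) (γ t) ≤ ψ t - ψ 0 := by
    intro n
    induction n with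
    | zero =>
      intro t ht htn
      have : t = 0 := le_antisymm (by simpa using htn) ht.1
      rw [this, hk.self _ (hγ 0 ⟨le_rfl, hL⟩), sub_self]
    | succ n ih =>
      intro t ht htn
      push_cast at htn
      have hs : max 0 (t - h₀) ∈ Icc 0 L :=
        ⟨le_max_left _ _, max_le hL (by linarith [ht.2])⟩
      have h1 := ih (max 0 (t - h₀)) hs (max_le (by positivity) (by linarith))
      have h2 := hstep (max 0 (t - h₀)) (t - max 0 (t - h₀)) hs.1
        (sub_nonneg.2 (max_le ht.1 (by linarith)))
        (by linarith [le_max_right 0 (t - h₀)]) (by linarith [ht.2])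
      rw [add_sub_cancel] at h2
      linarith [hk.triangle _ (hγ 0 ⟨le_rfl, hL⟩) _ (hγ _ hs) _ (hγ t ht)]
  obtain ⟨n, hn⟩ := exists_nat_ge (L / h₀)
  exact key n L ⟨hL, le_rfl⟩ ((div_le_iff₀ hh₀).1 hn)

theorem exists_first_exit {g : ℝ → ℝ} {L ρ : ℝ} (hg : ContinuousOn g (Icc 0 L)) (h0 : g 0 ≤ ρ) :
    (∀ t ∈ Icc 0 L, g t < ρ) ∨ ∃ t₁ ∈ Icc 0 L, g t₁ = ρ ∧ ∀ t ∈ Icc 0 t₁, g t ≤ ρ := by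
  refine or_iff_not_imp_left.2 fun h => ?_
  push Not at h
  obtain ⟨t₂, ht₂, hρ⟩ := h
  set B := Icc 0 L ∩ g ⁻¹' Ici ρ with hB
  have hcl : IsClosed B := hg.preimage_isClosed_of_isClosed isClosed_Icc isClosed_Ici
  have hbdd : BddBelow B := ⟨0, fun t ht => ht.1.1⟩
  have hm : sInf B ∈ B := hcl.csInf_mem ⟨t₂, ht₂, hρ⟩ hbdd
  have hgm : g (sInf B) = ρ := by
    obtain ⟨s, hs, hgs⟩ := intermediate_value_Icc hm.1.1
      (hg.mono (Icc_subset_Icc_right hm.1.2)) ⟨h0, hm.2⟩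
    have := csInf_le hbdd (show s ∈ B from ⟨⟨hs.1, hs.2.trans hm.1.2⟩, hgs.ge⟩)
    rw [← le_antisymm hs.2 this, hgs]
  refine ⟨_, hm.1, hgm, fun t ht => ?_⟩
  rcases eq_or_lt_of_le ht.2 with rfl | hlt
  · exact hgm.le
  · by_contra! hgt
    exact absurd (csInf_le hbdd (show t ∈ B from ⟨⟨ht.1, ht.2.trans hm.1.2⟩, hgt.le⟩))
      (not_le.2 hlt)

theorem IsGeodesicPath.continuousOn (hΩ : IsBoundedDomain Ω) {x y : EuclideanSpace ℂ (Fin d)}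
    {L : ℝ} {γ : ℝ → EuclideanSpace ℂ (Fin d)}
    (hγ : IsGeodesicPath Ω (kobayashiDist Ω) x y L γ) : ContinuousOn γ (Icc 0 L) := by
  obtain ⟨c, hc, hcK⟩ :=
    exists_mul_dist_le_kobayashiDist hΩ.isOpen hΩ.isConnected hΩ.isBounded
  refine (LipschitzOnWith.of_dist_le_mul (K := c⁻¹.toNNReal) fun s hs t ht => ?_).continuousOn
  rw [Real.coe_toNNReal _ (inv_pos.2 hc).le, le_inv_mul_iff₀ hc, Real.dist_eq]
  exact (hcK _ (hγ.mem s hs) _ (hγ.mem t ht)).trans (hγ.dist_eq s hs t ht).le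

/-- Local visibility at `p` yields a linear lower bound for the distance from the points near `p`
to the points that are far from `p`. -/
theorem exists_le_kobayashiDist_of_hasBoundedProducts (hΩ : IsBoundedDomain Ω)
    (hΩc : IsCompleteHyperbolic Ω) (hVo : IsOpen V) (hV : IsBoundedDomain (Ω ∩ V)) {r : ℝ}
    (hr : 0 < r) (hball : Metric.closedBall p r ⊆ V) (ho : o ∈ Ω ∩ V)
    (hB : HasBoundedProducts (Ω ∩ V) (Metric.closedBall p r) o) :
    ∃ c C, 0 < c ∧ ∀ z ∈ Ω, dist z p < r / 2 → ∀ w ∈ Ω, r ≤ dist w p →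
      c * kobayashiDist Ω z o - C ≤ kobayashiDist Ω z w := by
  obtain ⟨c₀, hc₀, hcK⟩ :=
    exists_mul_dist_le_kobayashiDist hΩ.isOpen hΩ.isConnected hΩ.isBounded
  obtain ⟨C, hC⟩ := hB (r / 4) (by positivity)
  -- Up to its exit from the ball of radius `3r/4` the geodesic is at Euclidean distance at least
  -- `r/4` from `Ω \ V`, hence at Kobayashi distance at least `R₀`. Steps of length at most `R₀ / 2`
  -- keep half of this margin.
  set R₀ := c₀ * (r / 4) with hR₀
  have hR₀pos : 0 < R₀ := by positivity
  have hT : 0 < Real.tanh (R₀ / 2) := Real.tanh_pos (by linarith)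
  refine ⟨Real.tanh (R₀ / 2), Real.tanh (R₀ / 2) * (2 * C), hT, fun z hz hzp w hw hwp => ?_⟩
  obtain ⟨γ, hγ⟩ := hΩ.exists_geodesic hΩc hz hw
  obtain h | ⟨t₁, ht₁, hgt, hle⟩ := exists_first_exit (g := fun t => dist (γ t) p)
    (ρ := 3 * r / 4) ((continuous_id.dist continuous_const).comp_continuousOn (hγ.continuousOn hΩ))
    (by rw [hγ.source]; linarith)
  · have := h _ ⟨hγ.nonneg, le_rfl⟩
    rw [hγ.target] at this
    linarith
  have hmem : ∀ t ∈ Icc 0 t₁, γ t ∈ Ω ∩ V := fun t ht =>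
    ⟨hγ.mem t ⟨ht.1, ht.2.trans ht₁.2⟩, hball (by
      rw [Metric.mem_closedBall]; linarith [hle t ht])⟩
  have hk := hV.isDistOn.le_sub_of_steps ht₁.1 (half_pos hR₀pos) hmem
    (fun s => (Real.tanh (R₀ / 2))⁻¹ * s) fun s h hs hh hhR hsh => by
      have e : kobayashiDist Ω (γ s) (γ (s + h)) = h := by
        rw [hγ.dist_of_le hs (by linarith) (by linarith [ht₁.2])]; ring
      have h1 := kobayashiDist_inter_le hVo hΩ.isOpen hΩ.isConnected hV.isConnected
        (hmem s ⟨hs, by linarith⟩).1 (hmem (s + h) ⟨by linarith, hsh⟩).1 (R := R₀)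
        (by rw [e]; linarith) fun w' hw' => by
          have hwV : r < dist w' p := by
            by_contra! hcon
            exact hw'.2 (hball hcon)
          have h2 := hcK _ (hmem s ⟨hs, by linarith⟩).1 _ hw'.1
          have h3 := dist_triangle w' (γ s) p
          rw [dist_comm w' (γ s)] at h3
          have h4 := hle s ⟨hs, by linarith⟩
          refine le_trans ?_ h2
          rw [hR₀]
          gcongr
          linarith
      rw [e] at h1
      have h2 : Real.tanh (R₀ / 2) ≤ Real.tanh (R₀ - h) := Real.tanh_le_tanh (by linarith)
      calc _ ≤ _ := h1
        _ ≤ h / Real.tanh (R₀ / 2) := by gcongr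
        _ = _ := by ring
  have hz' : z ∈ Ω ∩ V := by
    have := hmem 0 ⟨le_rfl, ht₁.1⟩
    rwa [hγ.source] at this
  have hm' := hmem t₁ ⟨ht₁.1, le_rfl⟩
  rw [hγ.source, mul_zero, sub_zero] at hk
  -- `z` and the exit point are at least `r/4` apart, so their product in `Ω ∩ V` is at most `C`.
  -- This bounds the distance from `z` to `o` by that to the exit point plus `2C`.
  have h1 := hC z ⟨hz', by rw [Metric.mem_closedBall]; linarith⟩ (γ t₁)
    ⟨hm', by rw [Metric.mem_closedBall]; linarith⟩ (by
      linarith [dist_triangle (γ t₁) z p, dist_comm (γ t₁) z])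
  rw [gromovProd] at h1
  have h2 := hV.isDistOn.nonneg hm' ho
  have h3 := kobayashiDist_anti hV.isOpen hV.isConnected (inter_subset_left : Ω ∩ V ⊆ Ω) hz' ho
  have h4 : kobayashiDist Ω z o - 2 * C ≤ (Real.tanh (R₀ / 2))⁻¹ * t₁ := by linarith
  rw [le_inv_mul_iff₀ hT] at h4
  linarith [ht₁.2]

/-- A geodesic that stays near `p` and whose distance to `o` grows linearly has bounded excess
length for the Kobayashi distance of `Ω ∩ U`. -/
theorem exists_kobayashiDist_inter_le_of_ray (hΩ : IsBoundedDomain Ω) (hUo : IsOpen U)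
    (hU : IsConnected (Ω ∩ U)) {r : ℝ} (hr : 0 < r) (hball : Metric.closedBall p r ⊆ U)
    {c C : ℝ} (hc : 0 < c) (hLB : ∀ z ∈ Ω, dist z p < r / 2 → ∀ w ∈ Ω, r ≤ dist w p →
      c * kobayashiDist Ω z o - C ≤ kobayashiDist Ω z w) :
    ∃ A, ∀ x y L γ, IsGeodesicPath Ω (kobayashiDist Ω) x y L γ →
      (∀ t ∈ Icc 0 L, dist (γ t) p < r / 2) → (∀ t ∈ Icc 0 L, t / 2 ≤ kobayashiDist Ω (γ t) o) →
      kobayashiDist (Ω ∩ U) x y ≤ L + A := by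
  obtain ⟨c₀, hc₀, hcK⟩ :=
    exists_mul_dist_le_kobayashiDist hΩ.isOpen hΩ.isConnected hΩ.isBounded
  set R₀ := c₀ * (r / 2) with hR₀
  have hR₀pos : 0 < R₀ := by positivity
  set A₀ := 2 / (1 - Real.exp (-(2 * (R₀ / 2)))) with hA₀
  have hA₀pos : 0 < A₀ :=
    div_pos two_pos (sub_pos.2 (Real.exp_lt_one_iff.2 (by linarith)))
  -- The first exponential comes from `2(R - h) ≥ c s - 2C - R₀` for `h ≤ R₀ / 2`, the second from
  -- `c h ≤ e^{ch}(1 - e^{-ch})`.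
  set A₁ := A₀ * Real.exp (2 * C + R₀) * Real.exp (c * (R₀ / 2)) with hA₁
  have hA₁pos : 0 < A₁ := by positivity
  refine ⟨A₁ / c, fun x y L γ hγ hnear hgrow => ?_⟩
  have hmem : ∀ t ∈ Icc 0 L, γ t ∈ Ω ∩ U := fun t ht =>
    ⟨hγ.mem t ht, hball (by rw [Metric.mem_closedBall]; linarith [hnear t ht])⟩
  -- The potential has derivative `1 + A₁ e^{-cs}`, which dominates the localization factor at time
  -- `s`; its total increment is at most `L + A₁ / c`.
  have hk := (isDistOn_kobayashiDist (hΩ.isOpen.inter hUo) hU).le_sub_of_steps hγ.nonneg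
    (half_pos hR₀pos) hmem (fun s => s - A₁ / c * Real.exp (-(c * s))) fun s h hs hh hhR hsh => by
      have hsI : s ∈ Icc 0 L := ⟨hs, by linarith⟩
      have e : kobayashiDist Ω (γ s) (γ (s + h)) = h := by
        rw [hγ.dist_of_le hs (by linarith) hsh]; ring
      -- The Euclidean bound `R₀` keeps `R - h` away from `0`, and the linear bound makes it grow
      -- with `s`.
      set R := max R₀ (c * (s / 2) - C) with hR
      have hRle := le_max_left R₀ (c * (s / 2) - C)
      have hRle' := le_max_right R₀ (c * (s / 2) - C)
      have h1 := kobayashiDist_inter_le hUo hΩ.isOpen hΩ.isConnected hU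
        (hmem s hsI).1 (hmem (s + h) ⟨by linarith, hsh⟩).1 (R := R)
        (by rw [e]; linarith) fun w' hw' => by
          have hwU : r < dist w' p := by
            by_contra! hcon
            exact hw'.2 (hball hcon)
          have h2 := hcK _ (hmem s hsI).1 _ hw'.1
          have h3 := dist_triangle w' (γ s) p
          rw [dist_comm w' (γ s)] at h3
          have h4 := hnear s hsI
          refine max_le ?_ ?_
          · refine le_trans ?_ h2
            rw [hR₀]
            gcongr
            linarith
          · refine le_trans ?_ (hLB _ (hmem s hsI).1 h4 w' hw'.1 hwU.le)
            have := mul_le_mul_of_nonneg_left (hgrow s hsI) hc.le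
            linarith
      rw [e] at h1
      have h2 := Real.inv_tanh_le (x := R - h) (half_pos hR₀pos) (by linarith)
      have h3 : Real.exp (-(2 * (R - h))) ≤ Real.exp (2 * C + R₀) * Real.exp (-(c * s)) := by
        rw [← Real.exp_add]
        exact Real.exp_le_exp.2 (by linarith)
      have h4 : c * h ≤ Real.exp (c * (R₀ / 2)) * (1 - Real.exp (-(c * h))) := by
        have h5 := Real.add_one_le_exp (c * h)
        have h6 : Real.exp (c * h) ≤ Real.exp (c * (R₀ / 2)) :=
          Real.exp_le_exp.2 (by gcongr)
        have h7 : Real.exp (-(c * h)) ≤ 1 := Real.exp_le_one_iff.2 (by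
          have := mul_nonneg hc.le hh; linarith)
        calc c * h ≤ Real.exp (c * h) * (1 - Real.exp (-(c * h))) := by
              rw [mul_sub, ← Real.exp_add]
              simp
              linarith
          _ ≤ _ := by
              have : 0 ≤ 1 - Real.exp (-(c * h)) := by linarith
              gcongr
      have h5 : Real.exp (-(c * (s + h))) = Real.exp (-(c * s)) * Real.exp (-(c * h)) := by
        rw [← Real.exp_add]; ring_nf
      have h6 : h * (Real.tanh (R - h))⁻¹ ≤
          h * (1 + A₀ * (Real.exp (2 * C + R₀) * Real.exp (-(c * s)))) := by
        gcongr
        exact h2.trans (by gcongr)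
      have h7 : h * (A₀ * (Real.exp (2 * C + R₀) * Real.exp (-(c * s)))) ≤
          A₁ / c * Real.exp (-(c * s)) * (1 - Real.exp (-(c * h))) := by
        calc h * (A₀ * (Real.exp (2 * C + R₀) * Real.exp (-(c * s))))
            = A₀ * Real.exp (2 * C + R₀) / c * Real.exp (-(c * s)) * (c * h) := by
              field_simp
          _ ≤ A₀ * Real.exp (2 * C + R₀) / c * Real.exp (-(c * s)) *
              (Real.exp (c * (R₀ / 2)) * (1 - Real.exp (-(c * h)))) := by gcongr
          _ = _ := by rw [hA₁]; ring
      rw [div_eq_mul_inv] at h1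
      rw [h5]
      linarith
  rw [hγ.source, hγ.target] at hk
  have h1 : 0 ≤ A₁ / c * Real.exp (-(c * L)) := by positivity
  simp only [mul_zero, neg_zero, Real.exp_zero, mul_one, zero_sub] at hk
  linarith

/-- A geodesic that stays near `p` has bounded excess length for the Kobayashi distance of
`Ω ∩ U`. -/
theorem exists_kobayashiDist_inter_le_of_geodesic (hΩ : IsBoundedDomain Ω) (hUo : IsOpen U)
    (hU : IsConnected (Ω ∩ U)) {r : ℝ} (hr : 0 < r) (hball : Metric.closedBall p r ⊆ U)
    (ho : o ∈ Ω) {c C : ℝ} (hc : 0 < c)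
    (hLB : ∀ z ∈ Ω, dist z p < r / 2 → ∀ w ∈ Ω, r ≤ dist w p →
      c * kobayashiDist Ω z o - C ≤ kobayashiDist Ω z w) :
    ∃ A, ∀ x y L γ, IsGeodesicPath Ω (kobayashiDist Ω) x y L γ →
      (∀ t ∈ Icc 0 L, dist (γ t) p < r / 2) → kobayashiDist (Ω ∩ U) x y ≤ L + A := by
  obtain ⟨A, hA⟩ := exists_kobayashiDist_inter_le_of_ray hΩ hUo hU hr hball hc hLB
  refine ⟨2 * A, fun x y L γ hγ hnear => ?_⟩
  have hmem : ∀ t ∈ Icc 0 L, γ t ∈ Ω ∩ U := fun t ht =>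
    ⟨hγ.mem t ht, hball (by rw [Metric.mem_closedBall]; linarith [hnear t ht])⟩
  have hcont : ContinuousOn (fun t => kobayashiDist Ω (γ t) o) (Icc 0 L) :=
    (continuousOn_kobayashiDist hΩ.isOpen hΩ.isConnected ho).comp (hγ.continuousOn hΩ) hγ.mem
  -- From the point nearest to `o`, `|t - t₀|` is at most the sum of the distances of `γ t` and `γ
  -- t₀` to `o`, so at most twice the former. Both halves, run outward from `t₀`, satisfy the growth
  -- hypothesis.
  obtain ⟨t₀, ht₀, hmin⟩ := isCompact_Icc.exists_isMinOn ⟨0, le_rfl, hγ.nonneg⟩ hcont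
  have hgrow : ∀ t ∈ Icc 0 L, |t - t₀| / 2 ≤ kobayashiDist Ω (γ t) o := fun t ht => by
    have h1 : kobayashiDist Ω (γ t₀) o ≤ kobayashiDist Ω (γ t) o := hmin ht
    have h2 := hΩ.isDistOn.triangle _ (hγ.mem t ht) o ho _ (hγ.mem t₀ ht₀)
    rw [hγ.dist_eq t ht t₀ ht₀, hΩ.isDistOn.symm o ho _ (hγ.mem t₀ ht₀)] at h2
    linarith
  have h1 := hA _ _ _ _ (hγ.sub ht₀.1 ht₀.2 le_rfl)
    (fun t ht => hnear _ ⟨by linarith [ht.1, ht₀.1], by linarith [ht.2]⟩) fun t ht => by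
      have := hgrow (t₀ + t) ⟨by linarith [ht.1, ht₀.1], by linarith [ht.2]⟩
      rwa [add_sub_cancel_left, abs_of_nonneg ht.1] at this
  have h2 := hA _ _ _ _ (hγ.sub le_rfl ht₀.1 ht₀.2).reverse
    (fun t ht => hnear _ ⟨by linarith [ht.2], by linarith [ht.1, ht₀.2]⟩) fun t ht => by
      have := hgrow (0 + (t₀ - 0 - t)) ⟨by linarith [ht.2], by linarith [ht.1, ht₀.2]⟩
      rw [abs_sub_comm, abs_of_nonneg (by linarith [ht.1])] at this
      linarith
  have hk := isDistOn_kobayashiDist (hΩ.isOpen.inter hUo) hU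
  have h3 := hk.triangle _ (hmem 0 ⟨le_rfl, hγ.nonneg⟩) _ (hmem t₀ ht₀) _
    (hmem L ⟨hγ.nonneg, le_rfl⟩)
  rw [hk.symm _ (hmem t₀ ht₀) _ (hmem 0 ⟨le_rfl, hγ.nonneg⟩)] at h2
  rw [hγ.source, hγ.target] at *
  linarith

end

noncomputable section

variable {d : ℕ} {Ω D U V : Set (EuclideanSpace ℂ (Fin d))} {o p : EuclideanSpace ℂ (Fin d)}

/-! ### Local visibility in terms of Gromov products -/

theorem HasBoundedProducts.mono {A A' : Set (EuclideanSpace ℂ (Fin d))}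
    (h : HasBoundedProducts D A o) (hA : D ∩ A' ⊆ A) : HasBoundedProducts D A' o := fun ε hε => by
  obtain ⟨C, hC⟩ := h ε hε
  exact ⟨C, fun x hx y hy => hC x ⟨hx.1, hA hx⟩ y ⟨hy.1, hA hy⟩⟩

theorem HasBoundedProductsAt.base (hD : IsBoundedDomain D) {q o' : EuclideanSpace ℂ (Fin d)}
    (ho : o ∈ D) (ho' : o' ∈ D) (h : HasBoundedProductsAt D o p q) :
    HasBoundedProductsAt D o' p q := by
  obtain ⟨C, hC⟩ := h
  refine ⟨C + kobayashiDist D o' o, hC.mono fun u hu h1 h2 => ?_⟩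
  linarith [hu h1 h2, hD.isDistOn.gromovProd_le_add ho' ho h1 h2]

theorem IsBoundedDomain.inter (hΩ : IsBoundedDomain Ω) (hVo : IsOpen V)
    (hV : IsConnected (Ω ∩ V)) : IsBoundedDomain (Ω ∩ V) :=
  ⟨hΩ.isOpen.inter hVo, hV, hΩ.isBounded.subset inter_subset_left⟩

/-- Inside `V`, a frontier point of `Ω ∩ V` is a frontier point of `Ω`; a small closed ball in `V'`
therefore meets only frontier points to which local visibility applies. -/
theorem IsLocallyVisibleAt.exists_hasBoundedProducts (hΩ : IsBoundedDomain Ω)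
    (h : IsLocallyVisibleAt Ω p) :
    ∃ V r, IsOpen V ∧ IsBoundedDomain (Ω ∩ V) ∧ 0 < r ∧ Metric.closedBall p r ⊆ V ∧
      ∀ o ∈ Ω ∩ V, HasBoundedProducts (Ω ∩ V) (Metric.closedBall p r) o := by
  obtain ⟨V, hVo, -, hVc, hVcomp, V', hV'o, hpV', hV'V, hvis⟩ := h
  obtain ⟨r, hr, hball⟩ := Metric.nhds_basis_closedBall.mem_iff.1 (hV'o.mem_nhds hpV')
  have hV := hΩ.inter hVo hVc
  refine ⟨V, r, hVo, hV, hr, hball.trans hV'V, fun o ho =>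
    HasBoundedProducts.of_at hV ho (isCompact_closedBall p r) fun a ha b hb hab =>
      (hvis a ?_ b ?_ hab).hasBoundedProductsAt hV hVcomp ho⟩
  all_goals
    have hfr : ∀ z ∈ frontier (Ω ∩ V) ∩ Metric.closedBall p r, z ∈ frontier Ω ∩ V' := by
      rintro z ⟨hz, hzb⟩
      refine ⟨?_, hball hzb⟩
      rw [hV.isOpen.frontier_eq] at hz
      rw [hΩ.isOpen.frontier_eq]
      exact ⟨closure_mono inter_subset_left hz.1, fun hzΩ => hz.2 ⟨hzΩ, hV'V (hball hzb)⟩⟩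
  · exact hfr a ha
  · exact hfr b hb

/-! ### Completeness -/

/-- A bounded domain that is complete hyperbolic near every boundary point is complete
hyperbolic. -/
theorem IsBoundedDomain.isCompleteHyperbolic_of_local (hΩ : IsBoundedDomain Ω)
    (h : ∀ p ∈ frontier Ω, ∃ U, IsOpen U ∧ p ∈ U ∧ IsConnected (Ω ∩ U) ∧
      IsCompleteHyperbolic (Ω ∩ U)) : IsCompleteHyperbolic Ω := by
  refine ⟨fun x hx y hy => hΩ.eq_of_kobayashiDist_eq_zero hx hy, fun u hu hcau => ?_⟩
  obtain ⟨c, hc, hcK⟩ :=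
    exists_mul_dist_le_kobayashiDist hΩ.isOpen hΩ.isConnected hΩ.isBounded
  have hcauE : CauchySeq u := Metric.cauchySeq_iff.2 fun ε hε => by
    obtain ⟨N, hN⟩ := hcau (c * ε) (by positivity)
    refine ⟨N, fun m hm n hn => lt_of_mul_lt_mul_left ?_ hc.le⟩
    exact (hcK _ (hu m) _ (hu n)).trans_lt (hN m hm n hn)
  obtain ⟨q, hq⟩ := cauchySeq_tendsto_of_complete hcauE
  have hqcl : q ∈ closure Ω := mem_closure_of_tendsto hq (Eventually.of_forall hu)
  by_cases hqΩ : q ∈ Ω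
  · refine ⟨q, hqΩ, ?_⟩
    refine ((tendsto_kobayashiDist_nhds hΩ.isOpen hqΩ).comp hq).congr fun n => ?_
    exact hΩ.isDistOn.symm _ hqΩ _ (hu n)
  -- If the Euclidean limit `q` were a boundary point, localization would make the tail Cauchy in
  -- the complete space `Ω ∩ U`, and its limit there would be `q ∈ Ω`.
  exfalso
  obtain ⟨U, hUo, hqU, hUc, hUcomp⟩ := h q (by
    rw [hΩ.isOpen.frontier_eq]; exact ⟨hqcl, hqΩ⟩)
  have hU := hΩ.inter hUo hUc
  obtain ⟨r, hr, hball⟩ := Metric.isOpen_iff.1 hUo q hqU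
  set R₀ := c * (r / 2) with hR₀
  have hR₀pos : 0 < R₀ := by positivity
  have hT : 0 < Real.tanh (R₀ / 2) := Real.tanh_pos (by linarith)
  obtain ⟨N, hN⟩ := Metric.tendsto_atTop.1 hq (r / 2) (by positivity)
  have hmem : ∀ n ≥ N, u n ∈ Ω ∩ U := fun n hn =>
    ⟨hu n, hball (by rw [Metric.mem_ball]; linarith [hN n hn])⟩
  have hcauU : ∀ ε : ℝ, 0 < ε → ∃ M, ∀ m ≥ M, ∀ n ≥ M,
      kobayashiDist (Ω ∩ U) (u (m + N)) (u (n + N)) < ε := by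
    intro ε hε
    obtain ⟨M, hM⟩ := hcau (min (R₀ / 2) (Real.tanh (R₀ / 2) * ε)) (by positivity)
    refine ⟨M, fun m hm n hn => ?_⟩
    have h1 := hM (m + N) (by omega) (n + N) (by omega)
    have h2 := h1.trans_le (min_le_left _ _)
    have h3 := h1.trans_le (min_le_right _ _)
    refine (kobayashiDist_inter_le hUo hΩ.isOpen hΩ.isConnected hUc (hu _) (hu _) (R := R₀)
      (by linarith) fun w' hw' => ?_).trans_lt ?_
    · have hwU : r ≤ dist w' q := by
        by_contra! hcon
        exact hw'.2 (hball hcon)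
      have h4 := hN (m + N) (by omega)
      have h5 := dist_triangle w' (u (m + N)) q
      rw [dist_comm w' (u (m + N))] at h5
      refine le_trans ?_ (hcK _ (hu _) _ hw'.1)
      rw [hR₀]
      gcongr
      linarith
    · have h4 : Real.tanh (R₀ / 2) ≤
          Real.tanh (R₀ - kobayashiDist Ω (u (m + N)) (u (n + N))) :=
        Real.tanh_le_tanh (by linarith)
      have h5 := kobayashiDist_nonneg (Ω := Ω) (u (m + N)) (u (n + N))
      rw [div_lt_iff₀ (hT.trans_le h4)]
      nlinarith
  obtain ⟨x, hx, hux⟩ := hUcomp.2 (fun n => u (n + N)) (fun n => hmem _ (by omega)) hcauU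
  obtain ⟨c', hc', hcK'⟩ :=
    exists_mul_dist_le_kobayashiDist hU.isOpen hU.isConnected hU.isBounded
  have hlim : Tendsto (fun n => u (n + N)) atTop (𝓝 x) := by
    rw [tendsto_iff_dist_tendsto_zero]
    refine squeeze_zero (fun n => dist_nonneg) (fun n => ?_)
      (by simpa using hux.const_mul c'⁻¹)
    rw [le_inv_mul_iff₀ hc']
    exact hcK' _ (hmem _ (by omega)) _ hx
  have := tendsto_nhds_unique hlim ((tendsto_add_atTop_iff_nat N).2 hq)
  exact hqΩ (this ▸ hx.1)

/-! ### From local to global visibility -/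

/-- A geodesic from a point near `p` that leaves a ball around `p` runs through a point whose
distance to `x` is almost the sum of the distances to `o`. -/
theorem exists_exit_point (hΩ : IsBoundedDomain Ω)
    (hΩc : IsCompleteHyperbolic Ω) (hVo : IsOpen V) (hV : IsBoundedDomain (Ω ∩ V)) {r : ℝ}
    (hr : 0 < r) (hball : Metric.closedBall p r ⊆ V) (ho : o ∈ Ω ∩ V)
    (hB : HasBoundedProducts (Ω ∩ V) (Metric.closedBall p r) o) :
    ∃ C, ∀ x y L γ, IsGeodesicPath Ω (kobayashiDist Ω) x y L γ → dist x p < r / 8 →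
      (∀ t ∈ Icc 0 L, dist (γ t) p < r / 4) ∨ ∃ t ∈ Icc 0 L, dist (γ t) p = r / 4 ∧
        (∀ s ∈ Icc 0 t, dist (γ s) p ≤ r / 4) ∧
        kobayashiDist Ω x o + kobayashiDist Ω (γ t) o ≤ kobayashiDist Ω x (γ t) + C := by
  obtain ⟨c, C, hc, hLB⟩ :=
    exists_le_kobayashiDist_of_hasBoundedProducts hΩ hΩc hVo hV hr hball ho hB
  obtain ⟨A, hA⟩ := exists_kobayashiDist_inter_le_of_geodesic hΩ hVo hV.isConnected hr hball
    ho.1 hc hLB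
  -- The start is within `r/8` of `p` and the exit is at `r/4`, so they are at least `r/8` apart,
  -- while the piece between them stays in the range of the additive comparison.
  obtain ⟨C', hC'⟩ := hB (r / 8) (by positivity)
  refine ⟨A + 2 * C', fun x y L γ hγ hxp => ?_⟩
  obtain h | ⟨t₁, ht₁, hgt, hle⟩ := exists_first_exit (g := fun t => dist (γ t) p)
    (ρ := r / 4) ((continuous_id.dist continuous_const).comp_continuousOn (hγ.continuousOn hΩ))
    (by rw [hγ.source]; linarith)
  · exact Or.inl h
  refine Or.inr ⟨t₁, ht₁, hgt, hle, ?_⟩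
  have hsub := hγ.sub le_rfl ht₁.1 ht₁.2
  have h1 := hA _ _ _ _ hsub fun t ht => by
    have := hle (0 + t) ⟨by linarith [ht.1], by linarith [ht.2]⟩
    linarith
  rw [hγ.source, sub_zero] at h1
  have hx : x ∈ Ω ∩ V := ⟨hγ.source_mem, hball (by rw [Metric.mem_closedBall]; linarith)⟩
  have hx' : γ t₁ ∈ Ω ∩ V := ⟨hγ.mem _ ht₁, hball (by rw [Metric.mem_closedBall]; linarith)⟩
  have h2 := hC' x ⟨hx, by rw [Metric.mem_closedBall]; linarith⟩ (γ t₁)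
    ⟨hx', by rw [Metric.mem_closedBall]; linarith⟩ (by
      linarith [dist_triangle (γ t₁) x p, dist_comm (γ t₁) x])
  rw [gromovProd] at h2
  have h3 := kobayashiDist_anti hV.isOpen hV.isConnected (inter_subset_left : Ω ∩ V ⊆ Ω) hx ho
  have h4 := kobayashiDist_anti hV.isOpen hV.isConnected (inter_subset_left : Ω ∩ V ⊆ Ω) hx' ho
  have h5 := hγ.dist_left ht₁
  linarith

/-- The geodesic from `x` to `y` has an exit point `x'`. Going from `y` to `o` through `x'` shows
that the excess bound at `x'` bounds the product of `x` and `y`. -/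
theorem exists_gromovProd_le_of_local (hΩ : IsBoundedDomain Ω)
    (hΩc : IsCompleteHyperbolic Ω) (hVo : IsOpen V) (hV : IsBoundedDomain (Ω ∩ V)) {r : ℝ}
    (hr : 0 < r) (hball : Metric.closedBall p r ⊆ V) (ho : o ∈ Ω ∩ V)
    (hB : HasBoundedProducts (Ω ∩ V) (Metric.closedBall p r) o) :
    ∃ C, ∀ x ∈ Ω, dist x p < r / 8 → ∀ y ∈ Ω, r / 4 ≤ dist y p →
      gromovProd (kobayashiDist Ω) o x y ≤ C := by
  obtain ⟨C, hC⟩ := exists_exit_point hΩ hΩc hVo hV hr hball ho hB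
  refine ⟨C / 2, fun x hx hxp y hy hyp => ?_⟩
  obtain ⟨γ, hγ⟩ := hΩ.exists_geodesic hΩc hx hy
  obtain h | ⟨t, ht, -, -, h⟩ := hC _ _ _ _ hγ hxp
  · have := h _ ⟨hγ.nonneg, le_rfl⟩
    rw [hγ.target] at this
    linarith
  · have h1 := hΩ.isDistOn.triangle _ hy _ (hγ.mem t ht) _ ho.1
    rw [hΩ.isDistOn.symm _ hy _ (hγ.mem t ht), hγ.dist_right ht] at h1
    rw [hγ.dist_left ht] at h
    rw [gromovProd]
    linarith

/-- Local visibility at all boundary points bounds the Gromov products of points that stay apart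
from each other. -/
theorem hasBoundedProducts_univ_of_local (hΩ : IsBoundedDomain Ω) (hΩc : IsCompleteHyperbolic Ω)
    (h : ∀ p ∈ frontier Ω, IsLocallyVisibleAt Ω p) (ho : o ∈ Ω) :
    HasBoundedProducts Ω univ o := by
  refine (HasBoundedProducts.of_at hΩ ho (A := closure Ω) hΩ.isBounded.isCompact_closure
    fun p hp q _ hpq => ?_).mono (inter_subset_left.trans subset_closure)
  obtain ⟨V, r₀, hVo, hV, hr₀, hball, hB⟩ := (h p hp.1).exists_hasBoundedProducts hΩ
  set r := min r₀ (dist p q) with hrdef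
  have hpq0 : 0 < dist p q := dist_pos.2 hpq
  have hr : 0 < r := lt_min hr₀ hpq0
  have hsub : Metric.closedBall p r ⊆ Metric.closedBall p r₀ :=
    Metric.closedBall_subset_closedBall (min_le_left _ _)
  obtain ⟨o', ho'⟩ := hV.isConnected.nonempty
  refine HasBoundedProductsAt.base hΩ ho'.1 ho ?_
  obtain ⟨C, hC⟩ := exists_gromovProd_le_of_local hΩ hΩc hVo hV hr (hsub.trans hball) ho'
    ((hB o' ho').mono (inter_subset_right.trans hsub))
  refine ⟨C, ?_⟩
  filter_upwards [prod_mem_nhds (Metric.ball_mem_nhds p (show 0 < r / 8 by positivity))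
    (Metric.ball_mem_nhds q (show 0 < r / 2 by positivity))] with u hu h1 h2
  refine hC _ h1 hu.1 _ h2 ?_
  have e1 : dist u.2 q < r / 2 := hu.2
  have e2 := dist_triangle p u.2 q
  rw [dist_comm p u.2] at e2
  linarith [min_le_right r₀ (dist p q)]

/-! ### From local to global Gromov hyperbolicity -/

/-- Additive localization of the Kobayashi distance near a boundary point. -/
theorem exists_kobayashiDist_inter_le_add (hΩ : IsBoundedDomain Ω)
    (hΩc : IsCompleteHyperbolic Ω) (hVo : IsOpen V) (hV : IsBoundedDomain (Ω ∩ V)) {r : ℝ}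
    (hr : 0 < r) (hball : Metric.closedBall p r ⊆ V) (ho : o ∈ Ω ∩ V)
    (hB : HasBoundedProducts (Ω ∩ V) (Metric.closedBall p r) o) (hUo : IsOpen U)
    (hU : IsBoundedDomain (Ω ∩ U)) (hballU : Metric.closedBall p r ⊆ U) (hoU : o ∈ U) :
    ∃ C, (∀ x ∈ Ω, dist x p < r / 8 → kobayashiDist (Ω ∩ U) x o ≤ kobayashiDist Ω x o + C) ∧
      ∀ x ∈ Ω, dist x p < r / 8 → ∀ y ∈ Ω, dist y p < r / 8 →
        kobayashiDist (Ω ∩ U) x y ≤ kobayashiDist Ω x y + C := by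
  obtain ⟨c, C₁, hc, hLB⟩ :=
    exists_le_kobayashiDist_of_hasBoundedProducts hΩ hΩc hVo hV hr hball ho hB
  obtain ⟨A, hA⟩ := exists_kobayashiDist_inter_le_of_geodesic hΩ hUo hU.isConnected hr hballU
    ho.1 hc hLB
  obtain ⟨C, hC⟩ := exists_exit_point hΩ hΩc hVo hV hr hball ho hB
  -- On a geodesic ending at `o` the excess bound forces the exit point to lie within `C / 2` of
  -- `o`. These points form a compact subset of `Ω ∩ U`, on which the local distance to `o` is
  -- bounded.
  set Q := {z | z ∈ Ω ∧ kobayashiDist Ω z o ≤ C / 2} ∩ Metric.sphere p (r / 4) with hQ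
  have hQU : Q ⊆ Ω ∩ U := fun z hz => ⟨hz.1.1, hballU (by
    have := hz.2
    rw [Metric.mem_sphere] at this
    rw [Metric.mem_closedBall]
    linarith)⟩
  obtain ⟨M, hM⟩ := (((hΩ.isCompact_closedBall hΩc ho.1 (C / 2)).inter_right
    Metric.isClosed_sphere).image_of_continuousOn
      ((continuousOn_kobayashiDist hU.isOpen hU.isConnected ⟨ho.1, hoU⟩).mono hQU)).bddAbove
  have hxU : ∀ x ∈ Ω, dist x p < r / 8 → x ∈ Ω ∩ U := fun x hx hxp =>
    ⟨hx, hballU (by rw [Metric.mem_closedBall]; linarith)⟩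
  have hK := hΩ.isDistOn
  have hk := hU.isDistOn
  have hbase : ∀ x ∈ Ω, dist x p < r / 8 →
      kobayashiDist (Ω ∩ U) x o ≤ kobayashiDist Ω x o + (A + max M 0) := by
    intro x hx hxp
    obtain ⟨γ, hγ⟩ := hΩ.exists_geodesic hΩc hx ho.1
    obtain h | ⟨t, ht, htp, hle, h⟩ := hC _ _ _ _ hγ hxp
    · have := hA _ _ _ _ hγ fun t ht => (h t ht).trans (by linarith)
      linarith [le_max_right M 0]
    · have h1 := hA _ _ _ _ (hγ.sub le_rfl ht.1 ht.2) fun s hs => by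
        have := hle (0 + s) ⟨by linarith [hs.1], by linarith [hs.2]⟩
        linarith
      rw [hγ.source] at h1
      rw [hγ.dist_left ht] at h
      have h2 := hγ.dist_right ht
      have hQt : γ t ∈ Q := ⟨⟨hγ.mem t ht, by linarith⟩, htp⟩
      have h3 : kobayashiDist (Ω ∩ U) (γ t) o ≤ M := hM ⟨γ t, hQt, rfl⟩
      have h4 := hk.triangle x (hxU x hx hxp) _ (hQU hQt) o ⟨ho.1, hoU⟩
      linarith [le_max_left M 0, ht.2]
  refine ⟨max (A + max M 0) (A + C + 2 * (A + max M 0)), fun x hx hxp =>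
    (hbase x hx hxp).trans (by gcongr; exact le_max_left _ _), fun x hx hxp y hy hyp => ?_⟩
  obtain ⟨γ, hγ⟩ := hΩ.exists_geodesic hΩc hx hy
  obtain h | ⟨t, ht, htp, hle, h⟩ := hC _ _ _ _ hγ hxp
  · have := hA _ _ _ _ hγ fun t ht => (h t ht).trans (by linarith)
    have e := le_max_left (A + max M 0) (A + C + 2 * (A + max M 0))
    linarith [le_max_right M 0]
  -- The geodesic leaves the ball, so passing through `o` costs at most `C` more than `K_Ω(x, y)`,
  -- and `hbase` compares both legs.
  · have e := le_max_right (A + max M 0) (A + C + 2 * (A + max M 0))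
    have h1 := hbase x hx hxp
    have h2 := hbase y hy hyp
    have h3 := hk.triangle x (hxU x hx hxp) o ⟨ho.1, hoU⟩ y (hxU y hy hyp)
    rw [hk.symm o ⟨ho.1, hoU⟩ y (hxU y hy hyp)] at h3
    have h4 := hK.triangle y hy _ (hγ.mem t ht) o ho.1
    rw [hK.symm y hy _ (hγ.mem t ht), hγ.dist_right ht] at h4
    rw [hγ.dist_left ht] at h
    have hA0 : 0 ≤ A := by
      have := hA x x 0 (fun _ => x) ⟨le_rfl, rfl, rfl, fun _ _ => hx, fun s hs t ht => by
        rw [hK.self x hx, le_antisymm hs.2 hs.1, le_antisymm ht.2 ht.1]; simp⟩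
        fun t ht => by linarith
      rwa [hk.self x (hxU x hx hxp), zero_add] at this
    linarith

/-- The four-point condition holds near a boundary point at which `Ω` is locally visible and
locally Gromov hyperbolic. -/
theorem exists_fourPoint_near (hΩ : IsBoundedDomain Ω) (hΩc : IsCompleteHyperbolic Ω)
    (hp : p ∈ frontier Ω) (hvis : IsLocallyVisibleAt Ω p)
    (hG : IsLocallyGromovHyperbolicAt Ω p) (ho : o ∈ Ω) :
    ∃ s δ, 0 < s ∧ ∀ x ∈ Ω ∩ Metric.ball p s, ∀ y ∈ Ω ∩ Metric.ball p s,
      ∀ z ∈ Ω ∩ Metric.ball p s, min (gromovProd (kobayashiDist Ω) o x y)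
        (gromovProd (kobayashiDist Ω) o y z) ≤ gromovProd (kobayashiDist Ω) o x z + δ := by
  obtain ⟨V, r₀, hVo, hV, hr₀, hball, hB⟩ := hvis.exists_hasBoundedProducts hΩ
  obtain ⟨U, hUo, hpU, hUc, -, hUG⟩ := hG
  have hU := hΩ.inter hUo hUc
  obtain ⟨r₁, hr₁, hballU⟩ := Metric.nhds_basis_closedBall.mem_iff.1 (hUo.mem_nhds hpU)
  set r := min r₀ r₁ with hrdef
  have hr : 0 < r := lt_min hr₀ hr₁
  have hsub : Metric.closedBall p r ⊆ Metric.closedBall p r₀ :=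
    Metric.closedBall_subset_closedBall (min_le_left _ _)
  have hsubU : Metric.closedBall p r ⊆ U :=
    (Metric.closedBall_subset_closedBall (min_le_right _ _)).trans hballU
  obtain ⟨o', ho'Ω, ho'⟩ := Metric.mem_closure_iff.1 (frontier_subset_closure hp) r hr
  have ho'b : o' ∈ Metric.closedBall p r := by
    rw [Metric.mem_closedBall, dist_comm]; exact ho'.le
  have ho'V : o' ∈ Ω ∩ V := ⟨ho'Ω, hball (hsub ho'b)⟩
  obtain ⟨C, hC₁, hC₂⟩ := exists_kobayashiDist_inter_le_add hΩ hΩc hVo hV hr (hsub.trans hball)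
    ho'V ((hB o' ho'V).mono (inter_subset_right.trans hsub)) hUo hU hsubU (hsubU ho'b)
  obtain ⟨δ, hδ⟩ := hU.isDistOn.exists_fourPointCondition hUG
  have hF := hδ o' ⟨ho'Ω, hsubU ho'b⟩
  -- Comparing products costs `C / 2` in one direction and `C` in the other, and each comparison
  -- changes the base point once.
  refine ⟨r / 8, δ + 2 * C + 2 * kobayashiDist Ω o o', by positivity, ?_⟩
  have hmemU : ∀ x ∈ Ω ∩ Metric.ball p (r / 8), x ∈ Ω ∩ U := fun x hx =>
    ⟨hx.1, hsubU (by
      have := hx.2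
      rw [Metric.mem_ball] at this
      rw [Metric.mem_closedBall]
      linarith)⟩
  have hanti : ∀ x ∈ Ω ∩ U, ∀ y ∈ Ω ∩ U, kobayashiDist Ω x y ≤ kobayashiDist (Ω ∩ U) x y :=
    fun x hx y hy => kobayashiDist_anti hU.isOpen hU.isConnected inter_subset_left hx hy
  have hcmp : ∀ x ∈ Ω ∩ Metric.ball p (r / 8), ∀ y ∈ Ω ∩ Metric.ball p (r / 8),
      gromovProd (kobayashiDist Ω) o x y ≤ gromovProd (kobayashiDist (Ω ∩ U)) o' x y + C / 2 +
        kobayashiDist Ω o o' ∧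
      gromovProd (kobayashiDist (Ω ∩ U)) o' x y ≤ gromovProd (kobayashiDist Ω) o x y + C +
        kobayashiDist Ω o o' := by
    intro x hx y hy
    have hoU : o' ∈ Ω ∩ U := ⟨ho'Ω, hsubU ho'b⟩
    have e1 := hΩ.isDistOn.gromovProd_le_add ho ho'Ω hx.1 hy.1
    have e2 := hΩ.isDistOn.gromovProd_le_add ho'Ω ho hx.1 hy.1
    rw [hΩ.isDistOn.symm o' ho'Ω o ho] at e2
    have e3 := hC₁ x hx.1 hx.2
    have e4 := hC₁ y hy.1 hy.2
    have e5 := hC₂ x hx.1 hx.2 y hy.1 hy.2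
    have e6 := hanti x (hmemU x hx) o' hoU
    have e7 := hanti y (hmemU y hy) o' hoU
    have e8 := hanti x (hmemU x hx) y (hmemU y hy)
    simp only [gromovProd] at e1 e2 ⊢
    constructor <;> linarith
  intro x hx y hy z hz
  have h1 := hF x (hmemU x hx) y (hmemU y hy) z (hmemU z hz)
  have hxy := (hcmp x hx y hy).1
  have hyz := (hcmp y hy z hz).1
  have hxz := (hcmp x hx z hz).2
  have hC0 : 0 ≤ C := by
    have h2 := hC₂ x hx.1 hx.2 x hx.1 hx.2
    rwa [hU.isDistOn.self x (hmemU x hx), hΩ.isDistOn.self x hx.1, zero_add] at h2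
  rcases min_le_iff.1 h1 with h | h
  · exact (min_le_left _ _).trans (by linarith)
  · exact (min_le_right _ _).trans (by linarith)

/-- Compactness is applied to the position of the middle point `y`. Near a point of `Ω` both
products are bounded by the distance from `y` to `o`. Near a boundary point either all three points
are close to it, or `x` or `z` is far from `y` and one of the products is bounded. -/
theorem exists_fourPointCondition_of_local (hΩ : IsBoundedDomain Ω)
    (hΩc : IsCompleteHyperbolic Ω) (hG : ∀ p ∈ frontier Ω, IsLocallyGromovHyperbolicAt Ω p)
    (hvis : ∀ p ∈ frontier Ω, IsLocallyVisibleAt Ω p) (ho : o ∈ Ω) :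
    ∃ δ, 0 < δ ∧ FourPointCondition Ω (kobayashiDist Ω) o δ := by
  have hB := hasBoundedProducts_univ_of_local hΩ hΩc hvis ho
  have hK := hΩ.isDistOn
  have : ∃ δ, ∀ y ∈ closure Ω, y ∈ Ω → ∀ x ∈ Ω, ∀ z ∈ Ω,
      min (gromovProd (kobayashiDist Ω) o x y) (gromovProd (kobayashiDist Ω) o y z) ≤
        gromovProd (kobayashiDist Ω) o x z + δ := by
    refine hΩ.isBounded.isCompact_closure.induction_on (p := fun T => ∃ δ, ∀ y ∈ T, y ∈ Ω →
      ∀ x ∈ Ω, ∀ z ∈ Ω, min (gromovProd (kobayashiDist Ω) o x y)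
        (gromovProd (kobayashiDist Ω) o y z) ≤ gromovProd (kobayashiDist Ω) o x z + δ)
      ⟨0, by simp⟩ ?_ ?_ ?_
    · rintro s t hst ⟨C, hC⟩
      exact ⟨C, fun u hu => hC u (hst hu)⟩
    · rintro s t ⟨C, hC⟩ ⟨C', hC'⟩
      refine ⟨max C C', fun y hy hyΩ x hx z hz => ?_⟩
      rcases hy with hy | hy
      · exact (hC y hy hyΩ x hx z hz).trans (by gcongr; exact le_max_left _ _)
      · exact (hC' y hy hyΩ x hx z hz).trans (by gcongr; exact le_max_right _ _)
    · intro q hq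
      by_cases hqΩ : q ∈ Ω
      · have hcont := (continuousOn_kobayashiDist hΩ.isOpen hΩ.isConnected ho).continuousAt
          (hΩ.isOpen.mem_nhds hqΩ)
        refine ⟨_, mem_nhdsWithin_of_mem_nhds (hcont.eventually (gt_mem_nhds (lt_add_one _))),
          kobayashiDist Ω q o + 1, fun y hy hyΩ x hx z hz => ?_⟩
        have hy' : kobayashiDist Ω y o < kobayashiDist Ω q o + 1 := hy
        refine (min_le_left _ _).trans ?_
        linarith [hK.gromovProd_le_right ho hx hyΩ, hK.gromovProd_nonneg ho hx hz]
      · have hqf : q ∈ frontier Ω := by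
          rw [hΩ.isOpen.frontier_eq]; exact ⟨hq, hqΩ⟩
        obtain ⟨s, δ, hs, hδ⟩ := exists_fourPoint_near hΩ hΩc hqf (hvis q hqf) (hG q hqf) ho
        obtain ⟨C, hC⟩ := hB (s / 2) (by positivity)
        refine ⟨Metric.ball q (s / 2), mem_nhdsWithin_of_mem_nhds
          (Metric.ball_mem_nhds q (by positivity)), max δ C, fun y hy hyΩ x hx z hz => ?_⟩
        rw [Metric.mem_ball] at hy
        have hfar : ∀ x, s ≤ dist x q → s / 2 ≤ dist x y := fun x hx => by
          linarith [dist_triangle x y q]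
        have hxz := hK.gromovProd_nonneg ho hx hz
        by_cases hxs : s ≤ dist x q
        · refine (min_le_left _ _).trans ?_
          linarith [hC x ⟨hx, mem_univ _⟩ y ⟨hyΩ, mem_univ _⟩ (hfar x hxs), le_max_right δ C]
        by_cases hzs : s ≤ dist z q
        · refine (min_le_right _ _).trans ?_
          have := hfar z hzs
          rw [dist_comm] at this
          linarith [hC y ⟨hyΩ, mem_univ _⟩ z ⟨hz, mem_univ _⟩ this, le_max_right δ C]
        · have := hδ x ⟨hx, not_le.1 hxs⟩ y ⟨hyΩ, Metric.mem_ball.2 (by linarith)⟩ z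
            ⟨hz, not_le.1 hzs⟩
          linarith [le_max_left δ C]
  obtain ⟨δ, hδ⟩ := this
  refine ⟨max δ 1, by positivity, fun x hx y hy z hz => ?_⟩
  linarith [hδ y (subset_closure hy) hy x hx z hz, le_max_left δ 1]

/-! ### From bounded products back to visibility, and the two implications -/

/-- With thin triangles a geodesic between separated points comes within `C + 3δ` of `o`; the closed
Kobayashi ball of this radius is the compact set required. -/
theorem HasBoundedProducts.isVisibleDomain (hΩ : IsBoundedDomain Ω)
    (hΩc : IsCompleteHyperbolic Ω) (hG : IsGromovHyperbolic Ω (kobayashiDist Ω)) (ho : o ∈ Ω)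
    (hB : HasBoundedProducts Ω univ o) : IsVisibleDomain Ω := by
  intro p _ q _ hpq
  have hε : 0 < dist p q / 3 := div_pos (dist_pos.2 hpq) (by norm_num)
  obtain ⟨C, hC⟩ := hB _ hε
  obtain ⟨hgeo, δ, hδ, hthin⟩ := hG
  have hfar : ∀ x ∈ Metric.ball p (dist p q / 3), ∀ y ∈ Metric.ball q (dist p q / 3),
      dist p q / 3 < dist x y := fun x hx y hy => by
    rw [Metric.mem_ball] at hx hy
    linarith [dist_triangle4 p x y q, dist_comm p x]
  refine ⟨_, Metric.ball_mem_nhds p hε, _, Metric.ball_mem_nhds q hε, _,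
    hΩ.isCompact_closedBall hΩc ho (C + 3 * δ), fun z hz => hz.1, ?_, ?_⟩
  · refine Set.disjoint_left.2 fun x hx hx' => ?_
    have := hfar x hx x hx'
    rw [dist_self] at this
    linarith
  · intro x hx y hy G hG'
    obtain ⟨c, hcG, hc⟩ := hΩ.isDistOn.exists_mem_geodesic_dist_le hgeo hδ hthin ho hG'
    refine ⟨c, hcG, (hΩ.isDistOn.gromovProd_le_of_mem_geodesic ho hG' hcG).1, hc.trans ?_⟩
    gcongr
    exact hC x ⟨hx.2, mem_univ _⟩ y ⟨hy.2, mem_univ _⟩ (hfar x hx.1 y hy.1).le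

theorem IsLocallyVisibleAndGromovHyperbolic.isVisibleAndGromovHyperbolic
    (hΩ : IsBoundedDomain Ω) (h : IsLocallyVisibleAndGromovHyperbolic Ω) :
    IsVisibleAndGromovHyperbolic Ω := by
  obtain ⟨hG, hvis⟩ := h
  have hΩc := hΩ.isCompleteHyperbolic_of_local fun p hp => by
    obtain ⟨U, hUo, hpU, hUc, hUcomp, -⟩ := hG p hp
    exact ⟨U, hUo, hpU, hUc, hUcomp⟩
  obtain ⟨o, ho⟩ := hΩ.isConnected.nonempty
  obtain ⟨δ, hδ, hF⟩ := exists_fourPointCondition_of_local hΩ hΩc hG hvis ho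
  have hGΩ := hF.isGromovHyperbolic hΩ.isDistOn (fun x hx y hy => by
    obtain ⟨γ, hγ⟩ := hΩ.exists_geodesic hΩc hx hy
    exact ⟨_, hγ.isGeodesicSegment⟩) ho hδ
  exact ⟨hΩc, (hasBoundedProducts_univ_of_local hΩ hΩc hvis ho).isVisibleDomain hΩ hΩc hGΩ ho, hGΩ⟩

theorem IsVisibleAndGromovHyperbolic.isLocallyVisibleAndGromovHyperbolic
    (hΩ : IsBoundedDomain Ω) (h : IsVisibleAndGromovHyperbolic Ω) :
    IsLocallyVisibleAndGromovHyperbolic Ω := by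
  obtain ⟨hc, hvis, hG⟩ := h
  refine ⟨fun p _ => ⟨univ, isOpen_univ, mem_univ _, ?_⟩,
    fun p _ => ⟨univ, isOpen_univ, mem_univ _, ?_⟩⟩
  · rw [inter_univ]
    exact ⟨hΩ.isConnected, hc, hG⟩
  · rw [inter_univ]
    exact ⟨hΩ.isConnected, hc, univ, isOpen_univ, mem_univ _, subset_rfl,
      fun q₁ h₁ q₂ h₂ => hvis q₁ h₁.1 q₂ h₂.1⟩

end

noncomputable section

variable {d : ℕ} {Ω : Set (EuclideanSpace ℂ (Fin d))} {o p : EuclideanSpace ℂ (Fin d)}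

/-! ### The extension of the identity to the Gromov compactification -/

theorem IsVisibleDomain.hasBoundedProducts (hΩ : IsBoundedDomain Ω) (hc : IsCompleteHyperbolic Ω)
    (hvis : IsVisibleDomain Ω) (ho : o ∈ Ω) : HasBoundedProducts Ω univ o :=
  (HasBoundedProducts.of_at hΩ ho (A := closure Ω) hΩ.isBounded.isCompact_closure
    fun p hp q hq hpq => (hvis p hp.1 q hq.1 hpq).hasBoundedProductsAt hΩ hc ho).mono
      (inter_subset_left.trans subset_closure)

/-- Terms at distance at least `ε` have bounded product, whereas the products of late terms tend to
infinity; so the sequence is Euclidean Cauchy. -/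
theorem GromovSeq.exists_tendsto (hB : HasBoundedProducts Ω univ o)
    (x : GromovSeq Ω (kobayashiDist Ω) o) : ∃ q ∈ closure Ω, Tendsto x.1 atTop (𝓝 q) := by
  have hcau : CauchySeq x.1 := Metric.cauchySeq_iff.2 fun ε hε => by
    obtain ⟨C, hC⟩ := hB ε hε
    obtain ⟨⟨N₁, N₂⟩, hN⟩ := eventually_atTop.1 (x.2.2.eventually_gt_atTop C)
    refine ⟨max N₁ N₂, fun m hm n hn => ?_⟩
    by_contra! hle
    exact absurd (hC _ ⟨x.2.1 m, mem_univ _⟩ _ ⟨x.2.1 n, mem_univ _⟩ hle)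
      (not_le.2 (hN (m, n) ⟨(le_max_left _ _).trans hm, (le_max_right _ _).trans hn⟩))
  obtain ⟨q, hq⟩ := cauchySeq_tendsto_of_complete hcau
  exact ⟨q, mem_closure_of_tendsto hq (Eventually.of_forall x.2.1), hq⟩

/-- If the Gromov products of two sequences are eventually larger than the products of points of
distance at least `ε / 3`, then the limits of the sequences have distance less than `ε`. -/
theorem dist_lt_of_gromovProd_gt {ε C : ℝ} (hε : 0 < ε)
    (hC : ∀ x ∈ Ω ∩ univ, ∀ y ∈ Ω ∩ univ, ε / 3 ≤ dist x y →
      gromovProd (kobayashiDist Ω) o x y ≤ C) {x y : ℕ → EuclideanSpace ℂ (Fin d)}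
    (hx : ∀ n, x n ∈ Ω) (hy : ∀ n, y n ∈ Ω) {a b : EuclideanSpace ℂ (Fin d)}
    (hxa : Tendsto x atTop (𝓝 a)) (hyb : Tendsto y atTop (𝓝 b))
    (hxy : ∀ᶠ ij : ℕ × ℕ in atTop, C < gromovProd (kobayashiDist Ω) o (x ij.1) (y ij.2)) :
    dist a b < ε := by
  have h1 := hxa.eventually (Metric.ball_mem_nhds a (show 0 < ε / 3 by positivity))
  have h2 := hyb.eventually (Metric.ball_mem_nhds b (show 0 < ε / 3 by positivity))
  rw [← prod_atTop_atTop_eq] at hxy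
  obtain ⟨⟨i, j⟩, ⟨h, hi⟩, hj⟩ := ((hxy.and (h1.prod_inl atTop)).and (h2.prod_inr atTop)).exists
  simp only at hi hj
  have hd : dist (x i) (y j) < ε / 3 := by
    by_contra! hle
    exact absurd (hC _ ⟨hx i, mem_univ _⟩ _ ⟨hy j, mem_univ _⟩ hle) (not_le.2 h)
  linarith [dist_triangle4 a (x i) (y j) b, dist_comm a (x i)]

theorem GromovSeq.Equivalent.limit_eq (hB : HasBoundedProducts Ω univ o)
    {x y : GromovSeq Ω (kobayashiDist Ω) o} (h : x.Equivalent y)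
    {a b : EuclideanSpace ℂ (Fin d)} (hxa : Tendsto x.1 atTop (𝓝 a))
    (hyb : Tendsto y.1 atTop (𝓝 b)) : a = b := by
  refine eq_of_forall_dist_le fun ε hε => ?_
  obtain ⟨C, hC⟩ := hB (ε / 3) (by positivity)
  exact (dist_lt_of_gromovProd_gt hε hC x.2.1 y.2.1 hxa hyb (h.eventually_gt_atTop C)).le

/-- Every boundary point is the limit of a sequence that converges at infinity. -/
theorem exists_gromovSeq_tendsto (hΩ : IsBoundedDomain Ω) (hc : IsCompleteHyperbolic Ω)
    (ho : o ∈ Ω) {q : EuclideanSpace ℂ (Fin d)} (hq : q ∈ frontier Ω) :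
    ∃ x : GromovSeq Ω (kobayashiDist Ω) o, Tendsto x.1 atTop (𝓝 q) := by
  have hK := hΩ.isDistOn
  obtain ⟨u, huΩ, hu⟩ := mem_closure_iff_seq_limit.1 (frontier_subset_closure hq)
  have hqΩ : q ∉ Ω := by
    rw [hΩ.isOpen.frontier_eq] at hq; exact hq.2
  have hle : (hyperfilter ℕ : Filter ℕ) ≤ atTop := by
    rw [← Nat.cofinite_eq_atTop]; exact hyperfilter_le_cofinite
  -- Closed Kobayashi balls are compact, hence Euclidean closed, and miss `q ∉ Ω`.
  have hinf : ∀ R : ℝ, ∀ᶠ n in (hyperfilter ℕ : Filter ℕ), R < kobayashiDist Ω o (u n) := by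
    intro R
    have hcl := (hΩ.isCompact_closedBall hc ho R).isClosed
    filter_upwards [hle (hu.eventually (hcl.isOpen_compl.mem_nhds fun h => hqΩ h.1))] with n hn
    by_contra! hcon
    exact hn ⟨huΩ n, by rwa [hK.symm _ (huΩ n) o ho]⟩
  choose γ hγ using fun n => hΩ.exists_geodesic hc ho (huΩ n)
  -- At integer times the geodesics from `o` to `u n` converge along the ultrafilter, as their
  -- points at time `N` lie in a compact ball; the limits `c N` act as a discrete ray.
  have hlim : ∀ N : ℕ, ∃ c ∈ Ω,
      Tendsto (fun n => γ n N) (hyperfilter ℕ : Filter ℕ) (𝓝 c) := by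
    intro N
    obtain ⟨c, hcm, hcl⟩ := (hΩ.isCompact_closedBall hc ho N).ultrafilter_le_nhds
      ((hyperfilter ℕ).map fun n => γ n N) (by
        rw [Ultrafilter.coe_map, le_principal_iff]
        refine mem_map.2 ((hinf N).mono fun n hn => ?_)
        have hNI : (N : ℝ) ∈ Icc 0 (kobayashiDist Ω o (u n)) := ⟨by positivity, hn.le⟩
        have hm := (hγ n).mem _ hNI
        exact ⟨hm, by rw [hK.symm _ hm o ho, (hγ n).dist_left hNI]⟩)
    exact ⟨c, hcm.1, hcl⟩
  choose c hcΩ hcl using hlim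
  have hgood : ∀ N : ℕ, ∀ᶠ n in (hyperfilter ℕ : Filter ℕ),
      (N : ℝ) < kobayashiDist Ω o (u n) ∧ kobayashiDist Ω (c N) (γ n N) < 1 / 2 := fun N =>
    (hinf N).and (((tendsto_kobayashiDist_nhds hΩ.isOpen (hcΩ N)).comp (hcl N)).eventually
      (gt_mem_nhds (by norm_num)))
  -- Diagonal choice: the `N`-th geodesic must follow the ray at all times up to and including `N`,
  -- so that any two of them can be compared at time `min i j`.
  have hpick : ∀ N : ℕ, ∃ n, (∀ M ∈ Finset.range (N + 1),
      (M : ℝ) < kobayashiDist Ω o (u n) ∧ kobayashiDist Ω (c M) (γ n M) < 1 / 2) ∧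
      dist (u n) q < 1 / ((N : ℝ) + 1) := fun N =>
    (((Filter.eventually_all_finset _).2 fun M _ => hgood M).and
      (hle (hu.eventually (Metric.ball_mem_nhds q (by positivity))))).exists
  choose n hn hnq using hpick
  -- At time `min i j` both geodesics are within `1 / 2` of the same point, hence within `1` of each
  -- other; the product halves this loss.
  have hprod : ∀ i j : ℕ, ((min i j : ℕ) : ℝ) - 1 / 2 ≤
      gromovProd (kobayashiDist Ω) o (u (n i)) (u (n j)) := by
    intro i j
    have key : ∀ k, min i j ≤ k →
        γ (n k) (min i j : ℕ) ∈ Ω ∧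
        kobayashiDist Ω (u (n k)) (γ (n k) (min i j : ℕ)) =
          kobayashiDist Ω (u (n k)) o - (min i j : ℕ) ∧
        kobayashiDist Ω (c (min i j)) (γ (n k) (min i j : ℕ)) < 1 / 2 := by
      intro k hk
      obtain ⟨h1, h2⟩ := hn k (min i j) (Finset.mem_range.2 (by omega))
      have hI : ((min i j : ℕ) : ℝ) ∈ Icc 0 (kobayashiDist Ω o (u (n k))) :=
        ⟨by positivity, h1.le⟩
      have hm := (hγ (n k)).mem _ hI
      refine ⟨hm, ?_, h2⟩
      rw [hK.symm _ (huΩ _) _ hm, (hγ (n k)).dist_right hI, hK.symm o ho _ (huΩ _)]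
    obtain ⟨a1, a2, a3⟩ := key i (min_le_left _ _)
    obtain ⟨b1, b2, b3⟩ := key j (min_le_right _ _)
    have t1 := hK.triangle _ (huΩ (n i)) _ a1 _ (huΩ (n j))
    have t2 := hK.triangle _ a1 _ (hcΩ (min i j)) _ (huΩ (n j))
    have t3 := hK.triangle _ (hcΩ (min i j)) _ b1 _ (huΩ (n j))
    rw [hK.symm _ a1 _ (hcΩ _)] at t2
    rw [hK.symm _ b1 _ (huΩ _)] at t3
    rw [gromovProd]
    linarith
  refine ⟨⟨fun N => u (n N), fun N => huΩ _, ?_⟩, ?_⟩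
  · refine tendsto_atTop_mono (fun ij => hprod ij.1 ij.2) ?_
    refine tendsto_atTop_add_const_right _ _ (tendsto_natCast_atTop_atTop.comp ?_)
    refine tendsto_atTop.2 fun b => ?_
    filter_upwards [eventually_ge_atTop (b, b)] with ij hij
    exact le_min hij.1 hij.2
  · rw [tendsto_iff_dist_tendsto_zero]
    exact squeeze_zero (fun _ => dist_nonneg) (fun N => (hnq N).le)
      tendsto_one_div_add_atTop_nhds_zero_nat

theorem IsVisibleAndGromovHyperbolic.exists_extension (hΩ : IsBoundedDomain Ω)
    (h : IsVisibleAndGromovHyperbolic Ω) (ho : o ∈ Ω) :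
    ∃ Φ : GromovClosure Ω (kobayashiDist Ω) o → closure Ω,
      Continuous Φ ∧ Function.Surjective Φ ∧
      ∀ z : Ω, (Φ (.inner z) : EuclideanSpace ℂ (Fin d)) = z := by
  obtain ⟨hc, hvis, -⟩ := h
  have hB := hvis.hasBoundedProducts hΩ hc ho
  obtain ⟨κ, hκ, hκK⟩ :=
    exists_mul_dist_le_kobayashiDist hΩ.isOpen hΩ.isConnected hΩ.isBounded
  choose lim hlimcl hlim using fun x : GromovSeq Ω (kobayashiDist Ω) o => x.exists_tendsto hB
  set bd : GromovBoundary Ω (kobayashiDist Ω) o → closure Ω :=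
    Quot.lift (fun x => ⟨lim x, hlimcl x⟩) fun x y hxy =>
      Subtype.ext (GromovSeq.Equivalent.limit_eq hB hxy (hlim x) (hlim y)) with hbd
  have hbdlim : ∀ ξ (x : GromovSeq Ω (kobayashiDist Ω) o), Quot.mk _ x = ξ →
      Tendsto x.1 atTop (𝓝 (bd ξ : EuclideanSpace ℂ (Fin d))) := by
    rintro _ x rfl
    exact hlim x
  let Φ : GromovClosure Ω (kobayashiDist Ω) o → closure Ω := fun p => match p with
    | .inner z => ⟨z.1, subset_closure z.2⟩
    | .bdry ξ => bd ξ
  refine ⟨Φ, continuous_def.2 fun O hO => ?_, ?_, fun z => rfl⟩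
  · intro p hp
    obtain ⟨ε, hε, hball⟩ := Metric.isOpen_iff.1 hO (Φ p) hp
    cases p with
    | inner z =>
      -- The basic neighbourhood is the Kobayashi ball of radius `κ ε`, which lies in the Euclidean
      -- ball of radius `ε`.
      refine ⟨1 / (κ * ε), by positivity, ?_⟩
      rintro _ ⟨y, rfl, hy⟩
      refine hball ?_
      rw [one_div_one_div] at hy
      have h1 : κ * dist z.1 y.1 < κ * ε := (hκK _ z.2 _ y.2).trans_lt hy
      rw [Metric.mem_ball, dist_comm]
      exact lt_of_mul_lt_mul_left h1 hκ.le
    | bdry ξ =>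
      obtain ⟨C, hC⟩ := hB (ε / 3) (by positivity)
      refine ⟨max C 0 + 1, by positivity, ?_⟩
      have hlt : C < max C 0 + 1 := by linarith [le_max_left C 0]
      rintro _ (⟨y, rfl, x, hx, hxy⟩ | ⟨η, rfl, x, y, hx, hy, hxy⟩)
      · refine hball ?_
        rw [Metric.mem_ball, dist_comm]
        refine dist_lt_of_gromovProd_gt hε hC x.2.1 (fun _ => y.2) (hbdlim ξ x hx)
          tendsto_const_nhds ?_
        obtain ⟨N, hN⟩ := eventually_atTop.1 hxy
        -- The interior point `y` is treated as a constant sequence, so only the first index is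
        -- constrained.
        exact eventually_atTop.2 ⟨(N, 0), fun ij hij => hlt.trans_le (hN _ hij.1)⟩
      · refine hball ?_
        rw [Metric.mem_ball, dist_comm]
        exact dist_lt_of_gromovProd_gt hε hC x.2.1 y.2.1 (hbdlim ξ x hx) (hbdlim η y hy)
          (hxy.mono fun i hi => hlt.trans_le hi)
  · rintro ⟨q, hq⟩
    by_cases hqΩ : q ∈ Ω
    · exact ⟨.inner ⟨q, hqΩ⟩, rfl⟩
    · obtain ⟨x, hx⟩ := exists_gromovSeq_tendsto hΩ hc ho (by
        rw [hΩ.isOpen.frontier_eq]; exact ⟨hq, hqΩ⟩)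
      exact ⟨.bdry (Quot.mk _ x), Subtype.ext (tendsto_nhds_unique (hlim x) hx)⟩

end

/-! ### The theorem -/

theorem theorem1p2 (d : ℕ) (Ω : Set (EuclideanSpace ℂ (Fin d)))
    (hΩo : IsOpen Ω) (hΩc : IsConnected Ω) (hΩb : Bornology.IsBounded Ω) :
    (IsVisibleAndGromovHyperbolic Ω ↔ IsLocallyVisibleAndGromovHyperbolic Ω) ∧
    (IsVisibleAndGromovHyperbolic Ω ∨ IsLocallyVisibleAndGromovHyperbolic Ω →
      ∀ o ∈ Ω, ∃ Φ : GromovClosure Ω (kobayashiDist Ω) o → closure Ω,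
        Continuous Φ ∧ Function.Surjective Φ ∧
        ∀ z : Ω, (Φ (.inner z) : EuclideanSpace ℂ (Fin d)) = z) := by
  have hΩ : IsBoundedDomain Ω := ⟨hΩo, hΩc, hΩb⟩
  refine ⟨⟨fun h => h.isLocallyVisibleAndGromovHyperbolic hΩ,
    fun h => h.isVisibleAndGromovHyperbolic hΩ⟩, fun h o ho => ?_⟩
  exact (h.elim id fun h => h.isVisibleAndGromovHyperbolic hΩ).exists_extension hΩ ho
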